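/- Let $F$ be a set of $n$ point light sources in the Euclidean plane and $p$ a point of the plane. A set $G$ of points *embraces* $p$ if $p\in\operatorname{int}\operatorname{CH}(G)$, where $\operatorname{CH}$ denotes the convex hull. When all light sources have range $r$, the point $p$ is *1-well illuminated* by $F$ if $\{f\in F : d(f,p)\le r\}$ embraces $p$. The *minimum embracing range* $\mathrm{MER}(F,p)$ is the least $r>0$ for which this happens; it exists if and only if $F$ embraces $p$. A source $f\in F$ is an *embracing site* for $p$ if $\{g\in F : d(g,p)\le d(f,p)\}$ embraces $p$, and a *closest embracing site* if moreover $d(f,p)$ is least possible. A *closest embracing triangle* $\mathrm{CET}(p)$ is a set of three sources of $F$ that embraces $p$ and contains a closest embracing site. **The algorithm MER-Point.** Compute the distances from $p$ to all light sources. Keep a set $K$ of sources, not embracing $p$, represented by at most three of them that span the same convex cone with apex $p$, and a list $X$ of candidates, all farther from $p$ than those in $K$; initially $K=\emptyset$ and $X=F$. As long as $X\neq\emptyset$, compute the median $m$ of the distances in $X$ by linear-time selection (medians of groups of five) and split $X$ into the sources at distance less than, equal to and greater than $m$. Test, by adding the first part to $K$ one source at a time, whether $K$ together with this part embraces $p$.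 If so, replace $X$ by this part (with the old $K$). If not, add this part to $K$ and then add the sources at distance $m$ one at a time; if some $f_p$ completes an embracing set, stop and return $f_p$ and $d(f_p,p)$, otherwise replace $X$ by the part at distance greater than $m$. If $X$ becomes empty, report that $F$ does not embrace $p$. At $f_p$, a triangle around $p$ is formed from $f_p$ and two of the sources representing $K$. If this is impossible, because these sources and $f_p$ lie on the four rays from $p$ of two lines through $p$, scan $F$ for a source at distance at most $d(f_p,p)$ off both lines and form a triangle with it and two of the four sources, if there is such a source. **Proposition.** In the unit-cost real RAM (arithmetic, square roots and comparisons of reals, index and list-cell operations, and procedure calls cost one step each) there is an absolute constant $C$ such that, for every point $p$ and every finite set $F$ of $n$ light sources, given in any order: 1. the test used by the algorithm decides correctly whether $p\in\operatorname{int}\operatorname{CH}(F)$, in at most $Cn$ steps if $n\ge1$; 2. MER-Point takes at most $Cn$ steps if $n\ge 1$; 3. MER-Point reports that there is no embracing range if and only if $p\notin\operatorname{int}\operatorname{CH}(F)$; 4. otherwise it returns $r=\mathrm{MER}(F,p)$ and a closest embracing site at distance $r$ from $p$. It also returns a closest embracing triangle all of whose vertices are at distance at most $r$ from $p$, whenever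 some three sources of $F$ at distance at most $r$ from $p$ embrace $p$, and in particular whenever there are no two segments with endpoints in $F$, not on a common line, that both contain $p$ in their relative interiors. -/

import Mathlib

open Set

noncomputable section

namespace MERPoint

/-! ### Geometry -/

/-- The Euclidean plane. -/
abbrev Plane := EuclideanSpace ℝ (Fin 2)

/-- `G` is an embracing set for `p`: `p` lies in the interior of the convex hull of `G`. -/
def IsEmbracingSet (G : Set Plane) (p : Plane) : Prop :=
  p ∈ interior (convexHull ℝ G)

/-- A site `f` of `F` is an embracing site for `p`: `p` is interior to the convex hull of `f` and
of the sites of `F` at least as close to `p` as `f`. -/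
def IsEmbracingSite (F : Set Plane) (p f : Plane) : Prop :=
  f ∈ F ∧ IsEmbracingSet {g | g ∈ F ∧ dist g p ≤ dist f p} p

/-- `f` is a closest embracing site of `F` for `p`. -/
def IsClosestEmbracingSite (F : Set Plane) (p f : Plane) : Prop :=
  IsEmbracingSite F p f ∧ ∀ g, IsEmbracingSite F p g → dist f p ≤ dist g p

/-- `T` is a closest embracing triangle `CET(F, p)`: three sites of `F` with `p` in the interior of
their triangle, one of them being a closest embracing site for `p`. -/
def IsCET (F : Set Plane) (p : Plane) (T : Set Plane) : Prop :=
  T ⊆ F ∧ T.ncard = 3 ∧ IsEmbracingSet T p ∧ ∃ f ∈ T, IsClosestEmbracingSite F p f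

/-- The region `A_r^E(T)` illuminated by all light sources of `T` with range `r` and embraced by
`T`. -/
def embracedArea (r : ℝ) (T : Set Plane) : Set Plane :=
  (⋂ f ∈ T, Metric.closedBall f r) ∩ interior (convexHull ℝ T)

/-- `p` is 1-well illuminated by `F` when all the light sources have range `r`: the light sources
that illuminate `p` form an embracing set for `p`. -/
def WellIlluminated (F : Set Plane) (p : Plane) (r : ℝ) : Prop :=
  IsEmbracingSet {f | f ∈ F ∧ p ∈ Metric.closedBall f r} p

/-- `r` is the minimum embracing range `MER(F, p)`. -/
def IsMER (F : Set Plane) (p : Plane) (r : ℝ) : Prop :=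
  IsLeast {s : ℝ | 0 < s ∧ WellIlluminated F p s} r

/-! ### Computations with a step count

The model is the unit-cost real RAM.  A computation is a value with the number of elementary steps
spent.  Programs touch reals, indices and list cells only through the unit-cost primitives below;
`step` is charged for each call of a recursive procedure together with the inspection of the first
cells of its list argument. Moving values and reading the fields of a constant-size record belong to
the charged step that uses them. -/

/-- A result together with the number of elementary steps spent to obtain it. -/
@[ext] structure Timed (α : Type) where
  /-- the result -/
  val : α
  /-- the number of steps -/
  time : ℕ

namespace Timed

instance : Monad Timed where
  pure a := ⟨a, 0⟩
  bind m f := ⟨(f m.val).val, m.time + (f m.val).time⟩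

end Timed

/-- A primitive operation with result `a`: one step. -/
def prim {α : Type} (a : α) : Timed α := ⟨a, 1⟩

/-- One procedure call, with the case distinction on its arguments: one step. -/
def step : Timed Unit := prim ()

/-- First coordinate of a point. -/
def readX (f : Plane) : Timed ℝ := prim (f 0)
/-- Second coordinate of a point. -/
def readY (f : Plane) : Timed ℝ := prim (f 1)
/-- Addition of reals. -/
def addR (x y : ℝ) : Timed ℝ := prim (x + y)
/-- Subtraction of reals. -/
def subR (x y : ℝ) : Timed ℝ := prim (x - y)
/-- Multiplication of reals. -/
def mulR (x y : ℝ) : Timed ℝ := prim (x * y)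
/-- Square root of a real. -/
def sqrtR (x : ℝ) : Timed ℝ := prim (Real.sqrt x)
open Classical in
/-- Comparison of reals. -/
def ltR (x y : ℝ) : Timed Bool := prim (decide (x < y))
/-- Addition of indices. -/
def addN (i j : ℕ) : Timed ℕ := prim (i + j)
/-- Truncated subtraction of indices. -/
def subN (i j : ℕ) : Timed ℕ := prim (i - j)
/-- Halving an index. -/
def halfN (i : ℕ) : Timed ℕ := prim (i / 2)
/-- Comparison of indices. -/
def ltN (i j : ℕ) : Timed Bool := prim (decide (i < j))
/-- A new list cell. -/
def consL {α : Type} (a : α) (l : List α) : Timed (List α) := prim (a :: l)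

/-- Length of a list. -/
def len {α : Type} : List α → Timed ℕ
  | [] => do
      step
      pure 0
  | _ :: l => do
      step
      let n ← len l
      addN n 1

/-! ### Selection in linear time by medians of groups of five -/

/-- Insert `x` into a sorted list. -/
def insertR (x : ℝ) : List ℝ → Timed (List ℝ)
  | [] => do
      step
      consL x []
  | y :: l => do
      step
      if ← ltR y x then
        let l' ← insertR x l
        consL y l'
      else
        let l' ← consL y l
        consL x l'

/-- Insertion sort; it is used only on lists of bounded length. -/
def sortR : List ℝ → Timed (List ℝ)
  | [] => do
      step
      pure []
  | x :: l => do
      step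
      let l' ← sortR l
      insertR x l'

/-- The entry of index `k` of a list, counted from `0` (and `0` past the end of the list). -/
def entry : List ℝ → ℕ → Timed ℝ
  | [], _ => do
      step
      pure 0
  | x :: _, 0 => do
      step
      pure x
  | _ :: l, k + 1 => do
      step
      entry l k

/-- The medians of the consecutive full groups of five entries. -/
def medians : List ℝ → Timed (List ℝ)
  | a :: b :: c :: d :: e :: l => do
      step
      let g ← prim [a, b, c, d, e]
      let s ← sortR g
      let m ← entry s 2
      let ms ← medians l
      consL m ms
  | _ => do
      step
      pure []

/-- Split a list into the entries with key less than, equal to and greater than `m`. -/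
def split {α : Type} (key : α → ℝ) (m : ℝ) :
    List α → Timed (List α × List α × List α)
  | [] => do
      step
      pure ([], [], [])
  | x :: l => do
      step
      let (lo, eq, hi) ← split key m l
      if ← ltR (key x) m then
        let lo' ← consL x lo
        pure (lo', eq, hi)
      else if ← ltR m (key x) then
        let hi' ← consL x hi
        pure (lo, eq, hi')
      else
        let eq' ← consL x eq
        pure (lo, eq', hi)

/-- The entry of rank `k`, counted from `0`, of a list in increasing order.  The first argument
bounds the depth of the recursion; the length of the list suffices. -/
def select : ℕ → ℕ → List ℝ → Timed ℝ
  | 0, _, _ => do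
      step
      pure 0
  | depth + 1, k, l => do
      step
      let n ← len l
      if ← ltN n 50 then
        let s ← sortR l
        entry s k
      else
        let ms ← medians l
        let g ← len ms
        let h ← halfN g
        let pivot ← select depth h ms
        let (lo, eq, hi) ← split id pivot l
        let i ← len lo
        if ← ltN k i then
          select depth k lo
        else
          let e ← len eq
          let j ← addN i e
          if ← ltN k j then
            pure pivot
          else
            let k' ← subN k j
            select depth k' hi

/-! ### Light sources seen from `p`, and the test for embracing sets -/

/-- A light source with its displacement from `p` and its distance to `p`. -/
structure Source where
  /-- the light source -/
  site : Plane
  /-- first coordinate of the displacement `site - p` -/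
  x : ℝ
  /-- second coordinate of the displacement `site - p` -/
  y : ℝ
  /-- distance to `p` -/
  d : ℝ

/-- Displacement and distance of one light source. -/
def locate (p f : Plane) : Timed Source := do
  let fx ← readX f
  let px ← readX p
  let fy ← readY f
  let py ← readY p
  let x ← subR fx px
  let y ← subR fy py
  let xx ← mulR x x
  let yy ← mulR y y
  let s ← addR xx yy
  let d ← sqrtR s
  prim ⟨f, x, y, d⟩

/-- Displacements and distances of all light sources. -/
def locateAll (p : Plane) : List Plane → Timed (List Source)
  | [] => do
      step
      pure []
  | f :: l => do
      step
      let u ← locate p f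
      let us ← locateAll p l
      consL u us

/-- The list of distances. -/
def distances : List Source → Timed (List ℝ)
  | [] => do
      step
      pure []
  | u :: l => do
      step
      let ds ← distances l
      consL u.d ds

/-- Orientation determinant of two displacements. -/
def det (u v : Source) : Timed ℝ := do
  let s ← mulR u.x v.y
  let t ← mulR u.y v.x
  subR s t

/-- Dot product of two displacements. -/
def dot (u v : Source) : Timed ℝ := do
  let s ← mulR u.x v.x
  let t ← mulR u.y v.y
  addR s t

/-- What is remembered of the light sources read so far: at most four of them, whose displacements
span the same convex cone with apex `p` as the displacements of all of them. -/
inductive Fan where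
  /-- nothing but possibly `p` itself -/
  | empty
  /-- a ray -/
  | ray (a : Source)
  /-- a line; `a` and `b` lie on opposite rays -/
  | line (a b : Source)
  /-- an angle less than `π`, counterclockwise from `a` to `b` -/
  | wedge (a b : Source)
  /-- a closed half-plane; `a` and `b` lie on opposite rays, `m` lies to the left of `a` -/
  | halfPlane (a m b : Source)
  /-- the plane; `p` is interior to the triangle -/
  | triangle (a b c : Source)
  /-- the plane; `a` and `b` lie on opposite rays, and so do `m` and `v` on another line -/
  | cross (a m b v : Source)

/-- Add one light source. -/
def Fan.extend (K : Fan) (v : Source) : Timed Fan := do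
  step
  match K with
  | .empty =>
      if ← ltR 0 v.d then pure (.ray v) else pure .empty
  | .ray a => do
      let s ← det a v
      if ← ltR 0 s then pure (.wedge a v)
      else if ← ltR s 0 then pure (.wedge v a)
      else
        let t ← dot a v
        if ← ltR t 0 then pure (.line a v) else pure (.ray a)
  | .line a b => do
      let s ← det a v
      if ← ltR 0 s then pure (.halfPlane a v b)
      else if ← ltR s 0 then pure (.halfPlane b v a)
      else pure (.line a b)
  | .wedge a b => do
      let s ← det a v
      let t ← det v b
      if ← ltR s 0 then
        if ← ltR t 0 then pure (.triangle a b v)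
        else if ← ltR 0 t then pure (.wedge v b)
        else pure (.halfPlane v a b)
      else if ← ltR t 0 then
        if ← ltR 0 s then pure (.wedge a v)
        else pure (.halfPlane a b v)
      else pure (.wedge a b)
  | .halfPlane a m b => do
      let s ← det a v
      if ← ltR s 0 then
        let t ← det v m
        if ← ltR 0 t then pure (.triangle m b v)
        else if ← ltR t 0 then pure (.triangle a m v)
        else pure (.cross a m b v)
      else pure (.halfPlane a m b)
  | .triangle a b c => pure (.triangle a b c)
  | .cross a m b w => pure (.cross a m b w)

/-- Add all light sources of a list. -/
def Fan.extendAll (K : Fan) : List Source → Timed Fan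
  | [] => do
      step
      pure K
  | v :: l => do
      step
      let K' ← K.extend v
      Fan.extendAll K' l

/-- Do the light sources read so far embrace `p`? -/
def Fan.isFull (K : Fan) : Timed Bool := do
  step
  match K with
  | .triangle _ _ _ => pure true
  | .cross _ _ _ _ => pure true
  | _ => pure false

/-- The test whether `p` lies in the interior of the convex hull of a list of points. -/
def embraceTest (p : Plane) (l : List Plane) : Timed Bool := do
  let us ← locateAll p l
  let K ← Fan.extendAll .empty us
  K.isFull

/-! ### The algorithm -/

/-- Add light sources one at a time until they embrace `p`; return the one that completes an
embracing set, if there is one, and the light sources remembered at that time. -/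
def Fan.complete (K : Fan) : List Source → Timed (Option Source × Fan)
  | [] => do
      step
      pure (none, K)
  | v :: l => do
      step
      let K' ← K.extend v
      if ← K'.isFull then pure (some v, K')
      else Fan.complete K' l

/-- Halving search.  `K` stands for the light sources already known to be closer than the closest
embracing site, `l` lists the remaining candidates.  Their median distance `m` splits `l`.  If `p`
is embraced by `K` and the closer half, the search continues in that half; otherwise this half is
added to `K`, the light sources at distance `m` are tried, and the search continues in the farther
half.  The first argument bounds the depth of the recursion; one more than the length of the list
suffices. -/
def search : ℕ → Fan → List Source → Timed (Option (Source × Fan))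
  | 0, _, _ => do
      step
      pure none
  | _ + 1, _, [] => do
      step
      pure none
  | depth + 1, K, u :: us => do
      step
      let l ← consL u us
      let n ← len l
      let h ← halfN n
      let ds ← distances l
      let m ← select n h ds
      let (near, mid, far) ← split Source.d m l
      let K₁ ← K.extendAll near
      if ← K₁.isFull then
        search depth K near
      else
        let (found, K₂) ← K₁.complete mid
        match found with
        | some f => prim (some (f, K₂))
        | none => search depth K₂ far

/-- Given `a`, `b` on opposite rays from `p`, and `m`, `v` on opposite rays of another line, with
`m` to the left of `a`, find a light source at distance at most `r` off both lines, and with it a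
triangle around `p`. -/
def offCross (a m b v : Source) (r : ℝ) :
    List Source → Timed (Option (Plane × Plane × Plane))
  | [] => do
      step
      pure none
  | u :: l => do
      step
      if ← ltR r u.d then offCross a m b v r l
      else
        let s ← det u m
        let t ← det a u
        if ← ltR 0 s then
          if ← ltR 0 t then prim (some (u.site, b.site, v.site))
          else if ← ltR t 0 then prim (some (u.site, b.site, m.site))
          else offCross a m b v r l
        else if ← ltR s 0 then
          if ← ltR 0 t then prim (some (u.site, a.site, v.site))
          else if ← ltR t 0 then prim (some (u.site, a.site, m.site))
          else offCross a m b v r l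
        else offCross a m b v r l

/-- What the algorithm returns. -/
structure Output where
  /-- a closest embracing site -/
  site : Plane
  /-- the minimum embracing range -/
  range : ℝ
  /-- a closest embracing triangle -/
  triangle : Option (Plane × Plane × Plane)

/-- The algorithm MER-Point.  The result `none` reports that the light sources do not embrace `p`
at all. -/
def merPoint (p : Plane) (l : List Plane) : Timed (Option Output) := do
  let us ← locateAll p l
  let n ← len us
  let depth ← addN n 1
  let res ← search depth .empty us
  match res with
  | none => pure none
  | some (f, K) =>
      match K with
      | .triangle a b c => prim (some ⟨f.site, f.d, some (a.site, b.site, c.site)⟩)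
      | .cross a m b v => do
          let t ← offCross a m b v f.d us
          prim (some ⟨f.site, f.d, t⟩)
      | _ => prim (some ⟨f.site, f.d, none⟩)

end MERPoint

end

namespace MERPoint

/-! ### Running times and linear-time selection -/

/-! The test works because the displacements of the sources read so far span a convex cone of
constant complexity. In the plane such a cone is the origin, a ray, a line, a wedge, a closed
half-plane or the whole plane, and a `Fan` names at most four sources spanning it. A few determinant
signs decide how one more source changes it (`Fan.Represents.extend`). The point `p` is embraced
exactly when the cone is the whole plane (`Fan.Represents.full_iff`). If it is not, all sources lie
in a closed half-plane with `p` on its boundary, and so does their hull; if it is, the fan exhibits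
a triangle or a convex quadrilateral around `p`.

Embracing is monotone in the set of sources. Hence the minimum embracing range is the distance `r`
for which the sources at distance at most `r` embrace `p` and those at distance less than `r` do
not; `search_spec` shows that the halving search ends at such an `r`. All sources known to be too
close are compressed into one fan, so a round costs time linear in the number of remaining
candidates only. A median split leaves at most half of them, and the costs form a geometric series
(`time_search_le`). This needs the median in linear time, which `select_spec` provides.

Three sources within distance `r` that embrace `p` must include one at distance exactly `r`, so they
automatically form a closest embracing triangle (`isCET_of_isEmbracingSet`). When the final fan is a
cross of two lines, a source in one of the four open sectors makes a triangle with the two rays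
bounding the opposite sector (`offCross_spec`). If every source within range is on one of the two
lines, then two of any three share a line through `p`, and no triple embraces `p`. -/

@[simp] theorem Timed.val_pure {α : Type} (a : α) : (pure a : Timed α).val = a := rfl
@[simp] theorem Timed.time_pure {α : Type} (a : α) : (pure a : Timed α).time = 0 := rfl
@[simp] theorem Timed.val_bind {α β : Type} (m : Timed α) (f : α → Timed β) :
    (m >>= f).val = (f m.val).val := rfl
@[simp] theorem Timed.time_bind {α β : Type} (m : Timed α) (f : α → Timed β) :
    (m >>= f).time = m.time + (f m.val).time := rfl
@[simp] theorem val_prim {α : Type} (a : α) : (prim a).val = a := rfl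
@[simp] theorem time_prim {α : Type} (a : α) : (prim a).time = 1 := rfl
@[simp] theorem time_step : step.time = 1 := rfl
attribute [simp] readX readY addR subR mulR sqrtR ltR addN subN halfN ltN consL

@[simp] theorem val_len {α : Type} (l : List α) : (len l).val = l.length := by
  induction l with
  | nil => simp [len]
  | cons a l ih => simp [len, ih]

@[simp] theorem time_len {α : Type} (l : List α) : (len l).time = 2 * l.length + 1 := by
  induction l with
  | nil => simp [len]
  | cons a l ih => simp [len, ih]; ring

@[simp] theorem val_insertR (x : ℝ) (l : List ℝ) :
    (insertR x l).val = l.orderedInsert (· ≤ ·) x := by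
  induction l with
  | nil => simp [insertR]
  | cons y l ih =>
    by_cases h : y < x
    · simp [insertR, h, ih, List.orderedInsert]
    · simp [insertR, h, List.orderedInsert, not_lt.mp h]

theorem time_insertR_le (x : ℝ) (l : List ℝ) : (insertR x l).time ≤ 3 * l.length + 4 := by
  induction l with
  | nil => simp [insertR]
  | cons y l ih =>
    by_cases h : y < x
    · simp [insertR, h]; omega
    · simp [insertR, h]

@[simp] theorem val_sortR (l : List ℝ) : (sortR l).val = l.insertionSort (· ≤ ·) := by
  induction l with
  | nil => simp [sortR]
  | cons y l ih => simp [sortR, ih]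

theorem time_sortR_le (l : List ℝ) (N : ℕ) (h : l.length ≤ N) :
    (sortR l).time ≤ (3 * N + 5) * l.length + 1 := by
  induction l with
  | nil => simp [sortR]
  | cons y l ih =>
    have h1 := time_insertR_le y (l.insertionSort (· ≤ ·))
    simp only [List.length_cons, List.length_insertionSort] at h h1
    have h2 := ih (by omega)
    simp [sortR]
    nlinarith

theorem val_entry (l : List ℝ) (k : ℕ) (h : k < l.length) : (entry l k).val = l[k] := by
  induction l generalizing k with
  | nil => simp at h
  | cons y l ih =>
    cases k with
    | zero => simp [entry]
    | succ k => simpa [entry] using ih k (by simpa using h)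

theorem time_entry_le (l : List ℝ) (k : ℕ) : (entry l k).time ≤ l.length + 1 := by
  induction l generalizing k with
  | nil => simp [entry]
  | cons y l ih =>
    cases k with
    | zero => simp [entry]
    | succ k => simp [entry]; have := ih k; omega

/-- `x` has rank `k`, counted from `0`, in the list `l`. -/
def HasRank (l : List ℝ) (k : ℕ) (x : ℝ) : Prop :=
  l.countP (· < x) ≤ k ∧ k < l.countP (· ≤ x)

theorem countP_le_eq (l : List ℝ) (x : ℝ) :
    l.countP (· ≤ x) = l.countP (· < x) + l.count x := by
  induction l with
  | nil => simp
  | cons y l ih =>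
    rcases lt_trichotomy y x with h | h | h
    · simp [h, h.le, h.ne, ih]; omega
    · subst h; simp [ih]; omega
    · simp [h.not_gt, h.not_ge, h.ne', ih]

theorem countP_lt_add_countP_ge (l : List ℝ) (x : ℝ) :
    l.countP (· < x) + l.countP (x ≤ ·) = l.length := by
  induction l with
  | nil => simp
  | cons y l ih =>
    by_cases h : y < x
    · simp [h, h.not_ge]; omega
    · simp [h, not_lt.mp h]; omega

theorem HasRank.mem {l : List ℝ} {k : ℕ} {x : ℝ} (h : HasRank l k x) : x ∈ l := by
  have := countP_le_eq l x
  have h' := h.1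
  have h'' := h.2
  exact List.count_pos_iff.mp (by omega)

theorem HasRank.perm {l l' : List ℝ} {k : ℕ} {x : ℝ} (h : HasRank l k x) (e : l.Perm l') :
    HasRank l' k x := by
  simpa [HasRank, e.countP_eq] using h

theorem hasRank_getElem_of_sorted (l : List ℝ) (hl : l.Pairwise (· ≤ ·)) (k : ℕ)
    (h : k < l.length) : HasRank l k l[k] := by
  induction l generalizing k with
  | nil => simp at h
  | cons y l ih =>
    rw [List.pairwise_cons] at hl
    cases k with
    | zero =>
      simp only [List.getElem_cons_zero, HasRank, List.countP_cons, lt_irrefl, le_refl]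
      refine ⟨?_, by simp⟩
      simp only [decide_false, Bool.false_eq_true, if_false, Nat.add_zero, Nat.le_zero]
      rw [List.countP_eq_zero]
      intro a ha
      simpa using hl.1 a ha
    | succ k =>
      have hk : k < l.length := by simpa using h
      have := ih hl.2 k hk
      have hy := hl.1 _ (List.getElem_mem hk)
      simp only [List.getElem_cons_succ, HasRank, List.countP_cons] at this ⊢
      simp only [hy, decide_true, if_true]
      constructor
      · have := this.1; split_ifs <;> omega
      · have := this.2; omega

theorem hasRank_entry_sortR (l : List ℝ) (k : ℕ) (h : k < l.length) :
    HasRank l k (entry (sortR l).val k).val := by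
  have h' : k < (l.insertionSort (· ≤ ·)).length := by simpa using h
  rw [val_sortR, val_entry _ _ h']
  exact (hasRank_getElem_of_sorted _ (List.pairwise_insertionSort _ _) k h').perm
    (List.perm_insertionSort _ _)

theorem medians_cons (a b c d e : ℝ) (l : List ℝ) :
    (medians (a :: b :: c :: d :: e :: l)).val =
      (entry (sortR [a, b, c, d, e]).val 2).val :: (medians l).val := by
  simp [medians]

theorem medians_eq_nil (l : List ℝ)
    (h : ∀ a b c d e l', l = a :: b :: c :: d :: e :: l' → False) : medians l = ⟨[], 1⟩ := by
  rw [medians.eq_2 l h]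
  rfl

theorem length_medians (l : List ℝ) : (medians l).val.length = l.length / 5 := by
  induction l using medians.induct with
  | case1 a b c d e l ih => rw [medians_cons]; simp [ih]; omega
  | case2 l h =>
    rcases l with _ | ⟨a, _ | ⟨b, _ | ⟨c, _ | ⟨d, _ | ⟨e, l⟩⟩⟩⟩⟩ <;>
      first | exact (h _ _ _ _ _ _ rfl).elim | simp [medians_eq_nil _ h]

theorem time_medians_le (l : List ℝ) : (medians l).time ≤ 25 * l.length + 1 := by
  induction l using medians.induct with
  | case1 a b c d e l ih =>
    have h1 := time_sortR_le [a, b, c, d, e] 5 (by simp)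
    have h2 := time_entry_le (sortR [a, b, c, d, e]).val 2
    rw [val_sortR, List.length_insertionSort] at h2
    simp only [List.length_cons, List.length_nil] at h1 h2
    simp only [medians, Timed.time_bind, val_prim, time_prim, time_step, consL,
      List.length_cons, val_sortR]
    omega
  | case2 l h =>
    simp [medians_eq_nil l h]

/-- The groups of five are disjoint, so each median satisfying `q` accounts for three entries of its
own. Keeping `q` abstract serves both the lower and the upper side of the pivot. -/
theorem three_mul_countP_medians_le (q : ℝ → Bool) (l : List ℝ)
    (hq : ∀ g : List ℝ, g.length = 5 → ∀ x, HasRank g 2 x → q x = true → 3 ≤ g.countP q) :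
    3 * (medians l).val.countP q ≤ l.countP q := by
  induction l using medians.induct with
  | case1 a b c d e l ih =>
    have h1 := hasRank_entry_sortR [a, b, c, d, e] 2 (by simp)
    have h2 := hq [a, b, c, d, e] (by simp) _ h1
    rw [medians_cons]
    have e5 : a :: b :: c :: d :: e :: l = [a, b, c, d, e] ++ l := rfl
    rw [e5, List.countP_append, List.countP_cons]
    split_ifs with h
    · have := h2 h; omega
    · omega
  | case2 l h =>
    simp [medians_eq_nil l h]

theorem three_mul_countP_le_medians (l : List ℝ) (x : ℝ) :
    3 * (medians l).val.countP (· ≤ x) ≤ l.countP (· ≤ x) := by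
  refine three_mul_countP_medians_le _ l fun g _ y hy hyx => ?_
  simp only [decide_eq_true_eq] at hyx
  have : g.countP (· ≤ y) ≤ g.countP (· ≤ x) :=
    List.countP_mono_left fun a _ ha => by simp at ha ⊢; exact ha.trans hyx
  exact hy.2.trans_le this

theorem three_mul_countP_ge_medians (l : List ℝ) (x : ℝ) :
    3 * (medians l).val.countP (x ≤ ·) ≤ l.countP (x ≤ ·) := by
  refine three_mul_countP_medians_le _ l fun g hg y hy hyx => ?_
  simp only [decide_eq_true_eq] at hyx
  have h1 : g.countP (y ≤ ·) ≤ g.countP (x ≤ ·) :=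
    List.countP_mono_left fun a _ ha => by simp at ha ⊢; exact hyx.trans ha
  have h2 := countP_lt_add_countP_ge g y
  have h3 := hy.1
  omega

open Classical in
theorem val_split {α : Type} (key : α → ℝ) (m : ℝ) (l : List α) :
    (split key m l).val = (l.filter (fun x => key x < m), l.filter (fun x => key x = m),
      l.filter (fun x => m < key x)) := by
  induction l with
  | nil => simp [split]
  | cons y l ih =>
    rcases lt_trichotomy (key y) m with h | h | h
    · simp [split, ih, h, h.ne, h.not_gt]
    · simp [split, ih, h]
    · simp [split, ih, h, h.ne', h.not_gt]

theorem time_split_le {α : Type} (key : α → ℝ) (m : ℝ) (l : List α) :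
    (split key m l).time ≤ 4 * l.length + 1 := by
  induction l with
  | nil => simp [split]
  | cons y l ih =>
    rcases lt_trichotomy (key y) m with h | h | h
    · simp [split, h]; omega
    · simp [split, h]; omega
    · simp [split, h, h.not_gt]; omega

open Classical in
-- An entry of the lower part is less than `m`, so the discarded entries, all at least `m`, enter
-- neither of the two counts.
theorem HasRank.of_filter_lt {l : List ℝ} {k : ℕ} {x m : ℝ}
    (h : HasRank (l.filter (fun y => y < m)) k x) : HasRank l k x := by
  have hx : x < m := by simpa using List.of_mem_filter h.mem
  unfold HasRank at h ⊢
  rw [List.countP_filter, List.countP_filter] at h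
  have e1 : ∀ y, (decide (y < x) && decide (y < m)) = decide (y < x) := fun y => by
    simpa using fun hy : y < x => hy.trans hx
  have e2 : ∀ y, (decide (y ≤ x) && decide (y < m)) = decide (y ≤ x) := fun y => by
    simpa using fun hy : y ≤ x => hy.trans_lt hx
  simpa only [e1, e2] using h

open Classical in
-- Applied with the comparisons to some `x > m` this shifts ranks; applied with `q` constantly true
-- it relates lengths.
theorem countP_eq_add_countP_filter_gt (q : ℝ → Bool) (m : ℝ) (l : List ℝ)
    (hq : ∀ y ≤ m, q y = true) :
    l.countP q = l.countP (· ≤ m) + (l.filter (fun y => m < y)).countP q := by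
  induction l with
  | nil => simp
  | cons y l ih =>
    rcases le_or_gt y m with h | h
    · simp [h, h.not_gt, hq y h, ih]; omega
    · simp [List.countP_cons, h, h.not_ge, ih]; omega

open Classical in
-- The discarded entries are at most `m`, hence less than `x`, and raise both counts by the same
-- amount.
theorem HasRank.of_filter_gt {l : List ℝ} {k : ℕ} {x m : ℝ} (hk : l.countP (· ≤ m) ≤ k)
    (h : HasRank (l.filter (fun y => m < y)) (k - l.countP (· ≤ m)) x) : HasRank l k x := by
  have hx : m < x := by simpa using List.of_mem_filter h.mem
  obtain ⟨h1, h2⟩ := h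
  have e1 := countP_eq_add_countP_filter_gt (· < x) m l
    (fun y hy => by simpa using hy.trans_lt hx)
  have e2 := countP_eq_add_countP_filter_gt (· ≤ x) m l
    (fun y hy => by simpa using hy.trans hx.le)
  constructor <;> omega

open Classical in
theorem length_filter_lt_add_length_filter_eq (l : List ℝ) (m : ℝ) :
    (l.filter (fun y => y < m)).length + (l.filter (fun y => y = m)).length =
      l.countP (· ≤ m) := by
  rw [countP_le_eq, List.countP_eq_length_filter, List.count_eq_length_filter]
  simp [beq_eq_decide]

open Classical in
-- With `g` full groups, at least `g / 2 + 1` medians are at most the pivot and at least `g - g / 2`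
-- are at least the pivot. Each brings three entries that are missing from the opposite strict part.
theorem length_filter_le_of_hasRank_medians (l : List ℝ) (m : ℝ)
    (h : HasRank (medians l).val (l.length / 5 / 2) m) :
    (l.filter (fun y => y < m)).length + 3 * (l.length / 5 - l.length / 5 / 2) ≤ l.length ∧
      (l.filter (fun y => m < y)).length + 3 * (l.length / 5 / 2 + 1) ≤ l.length := by
  obtain ⟨h1, h2⟩ := h
  have a1 := three_mul_countP_le_medians l m
  have a2 := three_mul_countP_ge_medians l m
  have a3 := countP_lt_add_countP_ge l m
  have a4 := countP_lt_add_countP_ge (medians l).val m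
  have a5 := length_medians l
  have a6 := countP_eq_add_countP_filter_gt (fun _ => true) m l (fun _ _ => rfl)
  simp only [List.countP_true] at a6
  rw [← List.countP_eq_length_filter]
  constructor <;> omega

theorem select_succ_of_lt (depth k : ℕ) (l : List ℝ) (h : l.length < 50) :
    (select (depth + 1) k l).val = (entry (sortR l).val k).val ∧
      (select (depth + 1) k l).time ≤ 200 * l.length + 20 := by
  have h1 := time_sortR_le l 50 h.le
  have h2 := time_entry_le (sortR l).val k
  rw [val_sortR, List.length_insertionSort] at h2
  simp only [select, Timed.val_bind, Timed.time_bind, val_len, time_len, ltN, val_prim, time_prim,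
    time_step, h, decide_true, if_true, true_and, val_sortR]
  omega

open Classical in
theorem select_succ_of_ge (depth k : ℕ) (l : List ℝ) (h : 50 ≤ l.length) (m : ℝ)
    (hm : m = (select depth (l.length / 5 / 2) (medians l).val).val) :
    (select (depth + 1) k l).val =
      (if k < (l.filter (fun y => y < m)).length then
        (select depth k (l.filter (fun y => y < m))).val
      else if k < l.countP (· ≤ m) then m
      else (select depth (k - l.countP (· ≤ m)) (l.filter (fun y => m < y))).val) ∧
    (select (depth + 1) k l).time ≤
      36 * l.length + 20 + (select depth (l.length / 5 / 2) (medians l).val).time +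
      (if k < (l.filter (fun y => y < m)).length then
        (select depth k (l.filter (fun y => y < m))).time
      else if k < l.countP (· ≤ m) then 0
      else (select depth (k - l.countP (· ≤ m)) (l.filter (fun y => m < y))).time) := by
  have t1 := time_medians_le l
  have t2 := time_split_le id m l
  have t3 := length_filter_lt_add_length_filter_eq l m
  have t4 : l.countP (· ≤ m) ≤ l.length := List.countP_le_length
  rw [← t3] at t4 ⊢
  simp only [select, Timed.val_bind, Timed.time_bind, val_len, time_len, ltN, val_prim, time_prim,
    time_step, h.not_gt, decide_false, Bool.false_eq_true, if_false, length_medians, halfN, ← hm,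
    val_split, id, addN, subN, decide_eq_true_eq]
  split_ifs with c1 c2
  · exact ⟨rfl, by omega⟩
  · simp only [Timed.val_bind, Timed.time_bind, val_len, time_len, val_prim, time_prim, c2,
      decide_true, if_true, Timed.val_pure, Timed.time_pure, true_and]
    omega
  · simp only [Timed.val_bind, Timed.time_bind, val_len, time_len, val_prim, time_prim, c2,
      decide_false, Bool.false_eq_true, if_false, true_and]
    omega

/-- With `g = l.length / 5`, the list of medians and the surviving part have together at most
`l.length - g / 2` entries (real division by 2). At 1000 steps per entry, the saving pays for the
`36 * l.length + 20` steps spent outside the recursive calls. -/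
theorem select_spec (depth k : ℕ) (l : List ℝ) (hl : l.length ≤ depth) (hk : k < l.length) :
    HasRank l k (select depth k l).val ∧ (select depth k l).time ≤ 1000 * l.length := by
  classical
  induction depth generalizing k l with
  | zero => omega
  | succ depth ih =>
    rcases lt_or_ge l.length 50 with h | h
    · obtain ⟨e1, e2⟩ := select_succ_of_lt depth k l h
      rw [e1]
      exact ⟨hasRank_entry_sortR l k hk, by omega⟩
    · obtain ⟨m, hm⟩ : ∃ m, m = (select depth (l.length / 5 / 2) (medians l).val).val := ⟨_, rfl⟩
      obtain ⟨e1, e2⟩ := select_succ_of_ge depth k l h m hm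
      have hlen := length_medians l
      obtain ⟨r1, r2⟩ := ih (l.length / 5 / 2) (medians l).val (by omega) (by omega)
      rw [← hm] at r1
      obtain ⟨b1, b2⟩ := length_filter_le_of_hasRank_medians l m r1
      have t3 := length_filter_lt_add_length_filter_eq l m
      have t4 := countP_eq_add_countP_filter_gt (fun _ => true) m l (fun _ _ => rfl)
      simp only [List.countP_true] at t4
      rw [e1]
      split_ifs at e2 ⊢ with c1 c2
      · obtain ⟨s1, s2⟩ := ih k (l.filter (fun y => y < m)) (by omega) c1
        exact ⟨s1.of_filter_lt, by omega⟩
      · refine ⟨⟨?_, c2⟩, by omega⟩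
        rw [not_lt, ← List.countP_eq_length_filter] at c1
        exact c1
      · obtain ⟨s1, s2⟩ := ih (k - l.countP (· ≤ m)) (l.filter (fun y => m < y)) (by omega)
          (by omega)
        exact ⟨s1.of_filter_gt (not_lt.mp c2), by omega⟩

/-! ### Embracing sets in coordinates -/

/-- Orientation determinant of `A` and `B` seen from `x`. -/
def orientation (x A B : Plane) : ℝ :=
  (A 0 - x 0) * (B 1 - x 1) - (A 1 - x 1) * (B 0 - x 0)

@[fun_prop]
theorem continuous_orientation (A B : Plane) : Continuous fun x => orientation x A B := by
  unfold orientation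
  fun_prop

theorem isOpen_orientation_pos (A B : Plane) : IsOpen {x | 0 < orientation x A B} :=
  isOpen_lt continuous_const (continuous_orientation A B)

/-- The three determinants, divided by their sum, are the barycentric coordinates of `x`, each
belonging to the vertex opposite to its edge. -/
theorem mem_convexHull_of_orientation (x A B C : Plane) (hAB : 0 ≤ orientation x A B)
    (hBC : 0 ≤ orientation x B C) (hCA : 0 ≤ orientation x C A)
    (h : 0 < orientation x A B + orientation x B C + orientation x C A) :
    x ∈ convexHull ℝ {A, B, C} := by
  set s := orientation x A B + orientation x B C + orientation x C A with hs
  have key := (convex_convexHull ℝ {A, B, C}).sum_mem (t := Finset.univ)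
    (w := ![orientation x B C / s, orientation x C A / s, orientation x A B / s])
    (z := ![A, B, C])
    (by intro i _; fin_cases i <;> simp <;> positivity)
    (by simp [Fin.sum_univ_three]; field_simp; rw [hs]; ring)
    (by intro i _; fin_cases i <;> exact subset_convexHull ℝ _ (by simp))
  convert key using 1
  simp only [Fin.sum_univ_three, Matrix.cons_val]
  ext i
  fin_cases i <;> simp <;> field_simp <;> rw [hs] <;> unfold orientation <;> ring

/-- The strict sign conditions define an open set that contains `p` and lies in the hull; it
therefore lies in the interior. -/
theorem isEmbracingSet_triangle (p A B C : Plane) (hAB : 0 < orientation p A B)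
    (hBC : 0 < orientation p B C) (hCA : 0 < orientation p C A) :
    IsEmbracingSet {A, B, C} p := by
  have hopen : IsOpen {x | 0 < orientation x A B ∧ 0 < orientation x B C ∧
      0 < orientation x C A} :=
    (isOpen_orientation_pos A B).inter
      ((isOpen_orientation_pos B C).inter (isOpen_orientation_pos C A))
  refine interior_maximal ?_ hopen ⟨hAB, hBC, hCA⟩
  rintro x ⟨h1, h2, h3⟩
  exact mem_convexHull_of_orientation x A B C h1.le h2.le h3.le (by positivity)

theorem isEmbracingSet_quadrilateral (p A B C D : Plane) (hAB : 0 < orientation p A B)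
    (hBC : 0 < orientation p B C) (hCD : 0 < orientation p C D) (hDA : 0 < orientation p D A) :
    IsEmbracingSet {A, B, C, D} p := by
  have hopen : IsOpen {x | 0 < orientation x A B ∧ 0 < orientation x B C ∧
      0 < orientation x C D ∧ 0 < orientation x D A} :=
    (isOpen_orientation_pos A B).inter ((isOpen_orientation_pos B C).inter
      ((isOpen_orientation_pos C D).inter (isOpen_orientation_pos D A)))
  refine interior_maximal ?_ hopen ⟨hAB, hBC, hCD, hDA⟩
  rintro x ⟨h1, h2, h3, h4⟩
  have hswap : orientation x C A = -orientation x A C := by unfold orientation; ring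
  -- The diagonal `AC` cuts the quadrilateral into two triangles; the sign tells which of them
  -- contains `x`.
  rcases le_total 0 (orientation x A C) with h | h
  · refine convexHull_mono ?_ (mem_convexHull_of_orientation x A C D h h3.le h4.le (by positivity))
    intro y; simp; tauto
  · have h' : 0 ≤ orientation x C A := by rw [hswap]; linarith
    refine convexHull_mono ?_ (mem_convexHull_of_orientation x A B C h1.le h2.le h' (by positivity))
    intro y; simp; tauto

theorem IsEmbracingSet.mono {G G' : Set Plane} {p : Plane} (h : IsEmbracingSet G p)
    (hG : G ⊆ G') : IsEmbracingSet G' p :=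
  interior_mono (convexHull_mono hG) h

/-- A closed half-plane is convex, so it contains the hull of `G`; as `p` is on its boundary, it is
not interior to the hull. -/
theorem not_isEmbracingSet_of_forall_le (G : Set Plane) (p : Plane) (w₀ w₁ : ℝ)
    (hw : w₀ ≠ 0 ∨ w₁ ≠ 0) (h : ∀ g ∈ G, w₀ * (g 0 - p 0) + w₁ * (g 1 - p 1) ≤ 0) :
    ¬ IsEmbracingSet G p := by
  intro hp
  have hhull : ∀ g ∈ convexHull ℝ G, w₀ * (g 0 - p 0) + w₁ * (g 1 - p 1) ≤ 0 := by
    refine convexHull_min (s := G) (t := {g | w₀ * (g 0 - p 0) + w₁ * (g 1 - p 1) ≤ 0}) h ?_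
    intro a ha b hb s t hs ht hst
    simp only [mem_ofPred_eq, PiLp.add_apply, PiLp.smul_apply, smul_eq_mul] at ha hb ⊢
    obtain rfl : s = 1 - t := by linarith
    nlinarith
  -- Moving from `p` by a small `ε > 0` along the outward normal would stay in the hull, but the
  -- linear form takes the value `ε * (w₀ ^ 2 + w₁ ^ 2) > 0` there.
  have hcont : Continuous fun ε : ℝ => p + ε • (!₂[w₀, w₁] : Plane) := by fun_prop
  have hnhds : {x | x ∈ convexHull ℝ G} ∈ nhds (p + (0 : ℝ) • (!₂[w₀, w₁] : Plane)) := by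
    simpa using mem_interior_iff_mem_nhds.mp hp
  have hev := hcont.continuousAt.eventually hnhds
  obtain ⟨ε, hmem, hε⟩ := ((hev.filter_mono nhdsWithin_le_nhds).and
    (self_mem_nhdsWithin (a := (0 : ℝ)) (s := Ioi 0))).exists
  have := hhull _ hmem
  simp only [PiLp.add_apply, PiLp.smul_apply, smul_eq_mul] at this
  simp at this
  have hε' : (0 : ℝ) < ε := hε
  have hpos : 0 < w₀ * w₀ + w₁ * w₁ := by
    rcases hw with hw | hw
    · have := mul_self_pos.mpr hw; nlinarith [mul_self_nonneg w₁]
    · have := mul_self_pos.mpr hw; nlinarith [mul_self_nonneg w₀]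
  nlinarith [mul_pos hε' hpos]

/-! ### Fans -/

namespace Source

/-- Orientation determinant of two displacements. -/
def cross (u v : Source) : ℝ := u.x * v.y - u.y * v.x

/-- Dot product of two displacements. -/
def inner (u v : Source) : ℝ := u.x * v.x + u.y * v.y

/-- The record of a light source is the one seen from `p`. -/
structure SeenFrom (p : Plane) (u : Source) : Prop where
  x_eq : u.x = u.site 0 - p 0
  y_eq : u.y = u.site 1 - p 1
  d_eq : u.d = dist u.site p

theorem SeenFrom.pos_iff {p : Plane} {u : Source} (h : u.SeenFrom p) :
    0 < u.d ↔ u.x ≠ 0 ∨ u.y ≠ 0 := by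
  rw [h.d_eq, h.x_eq, h.y_eq, dist_pos, Ne, ← not_and_or, not_iff_not]
  constructor
  · intro e; simp [e]
  · rintro ⟨e0, e1⟩
    ext i
    fin_cases i
    · simpa [sub_eq_zero] using e0
    · simpa [sub_eq_zero] using e1

theorem SeenFrom.orientation_eq {p : Plane} {u v : Source} (hu : u.SeenFrom p)
    (hv : v.SeenFrom p) : orientation p u.site v.site = u.cross v := by
  rw [orientation, cross, hu.x_eq, hu.y_eq, hv.x_eq, hv.y_eq]

@[simp] theorem cross_self (u : Source) : u.cross u = 0 := by unfold cross; ring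

theorem cross_swap (u v : Source) : u.cross v = -v.cross u := by unfold cross; ring

/-- The Plücker relation for four plane vectors. For a basis `a`, `b` it recovers the determinant of
`u` and `v` from their signs against `a` and `b`. -/
theorem cross_mul_cross (a b u v : Source) :
    a.cross b * u.cross v = a.cross u * b.cross v - a.cross v * b.cross u := by
  unfold cross; ring

/-- The determinant of `u` and `v` computed in the orthogonal basis formed by `a` and its rotation
by a right angle. When one of the vectors is parallel to `a`, one term vanishes and signs can be
transported. -/
theorem inner_self_mul_cross (a u v : Source) :
    a.inner a * u.cross v = a.inner u * a.cross v - a.inner v * a.cross u := by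
  unfold cross inner; ring

theorem inner_comm (u v : Source) : u.inner v = v.inner u := by unfold inner; ring

theorem inner_self_nonneg (u : Source) : 0 ≤ u.inner u := by
  unfold inner; nlinarith [mul_self_nonneg u.x, mul_self_nonneg u.y]

theorem inner_self_pos {u : Source} (h : u.x ≠ 0 ∨ u.y ≠ 0) : 0 < u.inner u := by
  unfold inner
  rcases h with h | h
  · have := mul_self_pos.mpr h; nlinarith [mul_self_nonneg u.y]
  · have := mul_self_pos.mpr h; nlinarith [mul_self_nonneg u.x]

theorem ne_zero_of_cross_ne {u v : Source} (h : u.cross v ≠ 0) : u.x ≠ 0 ∨ u.y ≠ 0 := by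
  by_contra! h0
  exact h (by simp [cross, h0.1, h0.2])

theorem ne_zero_of_inner_ne {u v : Source} (h : u.inner v ≠ 0) : u.x ≠ 0 ∨ u.y ≠ 0 := by
  by_contra! h0
  exact h (by simp [inner, h0.1, h0.2])

end Source

@[simp] theorem val_det (u v : Source) : (det u v).val = u.cross v := rfl
@[simp] theorem time_det (u v : Source) : (det u v).time = 3 := rfl
@[simp] theorem val_dot (u v : Source) : (dot u v).val = u.inner v := rfl
@[simp] theorem time_dot (u v : Source) : (dot u v).time = 3 := rfl

/-- The light sources remembered in `K` belong to `S` and their displacements span the same convex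
cone as the displacements of `S`. -/
def Fan.Represents : Fan → Set Source → Prop
  | .empty, S => ∀ u ∈ S, u.x = 0 ∧ u.y = 0
  | .ray a, S => a ∈ S ∧ 0 < a.inner a ∧ ∀ u ∈ S, a.cross u = 0 ∧ 0 ≤ a.inner u
  | .line a b, S => a ∈ S ∧ b ∈ S ∧ a.cross b = 0 ∧ a.inner b < 0 ∧ ∀ u ∈ S, a.cross u = 0
  | .wedge a b, S => a ∈ S ∧ b ∈ S ∧ 0 < a.cross b ∧ ∀ u ∈ S, 0 ≤ a.cross u ∧ 0 ≤ u.cross b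
  | .halfPlane a m b, S => a ∈ S ∧ m ∈ S ∧ b ∈ S ∧ a.cross b = 0 ∧ a.inner b < 0 ∧
      0 < a.cross m ∧ ∀ u ∈ S, 0 ≤ a.cross u
  | .triangle a b c, S => a ∈ S ∧ b ∈ S ∧ c ∈ S ∧
      0 < a.cross b ∧ 0 < b.cross c ∧ 0 < c.cross a
  | .cross a m b v, S => a ∈ S ∧ m ∈ S ∧ b ∈ S ∧ v ∈ S ∧ a.cross b = 0 ∧ a.inner b < 0 ∧
      0 < a.cross m ∧ m.cross v = 0 ∧ m.inner v < 0

/-- The represented light sources embrace `p`. -/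
def Fan.Full : Fan → Prop
  | .triangle _ _ _ => True
  | .cross _ _ _ _ => True
  | _ => False

@[simp] theorem Fan.val_isFull (K : Fan) : K.isFull.val = true ↔ K.Full := by
  cases K <;> simp [Fan.isFull, Fan.Full]

@[simp] theorem Fan.time_isFull (K : Fan) : K.isFull.time = 1 := by
  cases K <;> simp [Fan.isFull]

theorem Fan.time_extend_le (K : Fan) (v : Source) : (K.extend v).time ≤ 12 := by
  cases K with
  | empty => by_cases h : 0 < v.d <;> simp [Fan.extend, h]
  | ray a =>
    by_cases h1 : 0 < a.cross v <;> by_cases h2 : a.cross v < 0 <;>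
      by_cases h3 : a.inner v < 0 <;> simp [Fan.extend, h1, h2, h3]
  | line a b =>
    by_cases h1 : 0 < a.cross v <;> by_cases h2 : a.cross v < 0 <;> simp [Fan.extend, h1, h2]
  | wedge a b =>
    by_cases h1 : 0 < a.cross v <;> by_cases h2 : a.cross v < 0 <;>
      by_cases h3 : 0 < v.cross b <;> by_cases h4 : v.cross b < 0 <;>
      simp [Fan.extend, h1, h2, h3, h4]
  | halfPlane a m b =>
    by_cases h1 : a.cross v < 0 <;> by_cases h2 : 0 < v.cross m <;>
      by_cases h3 : v.cross m < 0 <;> simp [Fan.extend, h1, h2, h3]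
  | triangle => simp [Fan.extend]
  | cross => simp [Fan.extend]

theorem Fan.Represents.not_isEmbracingSet {K : Fan} {S : Set Source} {p : Plane}
    (hK : K.Represents S) (hS : ∀ u ∈ S, u.SeenFrom p) (hfull : ¬ K.Full) :
    ¬ IsEmbracingSet (Source.site '' S) p := by
  obtain ⟨w₀, w₁, hw, h⟩ : ∃ w₀ w₁ : ℝ, (w₀ ≠ 0 ∨ w₁ ≠ 0) ∧ ∀ u ∈ S, w₀ * u.x + w₁ * u.y ≤ 0 := by
    -- The normal is `a` turned clockwise by a right angle; its product with `u` is `-a.cross u`.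
    have aux : ∀ a : Source, (a.x ≠ 0 ∨ a.y ≠ 0) → (∀ u ∈ S, 0 ≤ a.cross u) →
        ∃ w₀ w₁ : ℝ, (w₀ ≠ 0 ∨ w₁ ≠ 0) ∧ ∀ u ∈ S, w₀ * u.x + w₁ * u.y ≤ 0 := fun a ha h =>
      ⟨a.y, -a.x, by simpa [or_comm] using ha, fun u hu => by
        have := h u hu; unfold Source.cross at this; linarith⟩
    cases K with
    | empty => exact ⟨1, 0, by simp, fun u hu => by simp [(hK u hu).1]⟩
    | ray a =>
      refine ⟨-a.x, -a.y, by simpa using Source.ne_zero_of_inner_ne hK.2.1.ne', fun u hu => ?_⟩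
      have := (hK.2.2 u hu).2
      unfold Source.inner at this; linarith
    | line a b =>
      exact aux a (Source.ne_zero_of_inner_ne hK.2.2.2.1.ne)
        (fun u hu => (hK.2.2.2.2 u hu).ge)
    | wedge a b =>
      exact aux a (Source.ne_zero_of_cross_ne hK.2.2.1.ne')
        (fun u hu => (hK.2.2.2 u hu).1)
    | halfPlane a m b =>
      exact aux a (Source.ne_zero_of_inner_ne hK.2.2.2.2.1.ne)
        hK.2.2.2.2.2.2
    | triangle a b c => exact (hfull trivial).elim
    | cross a m b v => exact (hfull trivial).elim
  refine not_isEmbracingSet_of_forall_le _ p w₀ w₁ hw ?_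
  rintro _ ⟨u, hu, rfl⟩
  rw [← (hS u hu).x_eq, ← (hS u hu).y_eq]
  exact h u hu

/-- Here `b` and `v` are negative multiples of `a` and `m`, so the order `a`, `m`, `b`, `v` is
counterclockwise with every turn less than `π`. -/
theorem Source.cross_signs_of_opposite {a m b v : Source} (hab : a.cross b = 0)
    (hab' : a.inner b < 0) (ham : 0 < a.cross m) (hmv : m.cross v = 0) (hmv' : m.inner v < 0) :
    0 < m.cross b ∧ 0 < b.cross v ∧ 0 < v.cross a := by
  have ha := inner_self_pos (ne_zero_of_inner_ne hab'.ne)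
  have hm := inner_self_pos (ne_zero_of_inner_ne hmv'.ne)
  have h1 := inner_self_mul_cross a m b
  have h2 := inner_self_mul_cross a b v
  have h3 := inner_self_mul_cross m v a
  rw [hab, mul_zero, zero_sub] at h1
  rw [hab, mul_zero, sub_zero] at h2
  rw [hmv, mul_zero, sub_zero, cross_swap m a] at h3
  have h4 : 0 < v.cross a := pos_of_mul_pos_right (a := m.inner m) (by rw [h3]; nlinarith) hm.le
  refine ⟨pos_of_mul_pos_right (a := a.inner a) (by rw [h1]; nlinarith) ha.le,
    pos_of_mul_pos_right (a := a.inner a) ?_ ha.le, h4⟩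
  rw [h2, cross_swap a v]
  nlinarith

theorem Fan.Represents.isEmbracingSet {K : Fan} {S : Set Source} {p : Plane}
    (hK : K.Represents S) (hS : ∀ u ∈ S, u.SeenFrom p) (hfull : K.Full) :
    IsEmbracingSet (Source.site '' S) p := by
  cases K with
  | triangle a b c =>
    obtain ⟨ha, hb, hc, h1, h2, h3⟩ := hK
    rw [← (hS a ha).orientation_eq (hS b hb)] at h1
    rw [← (hS b hb).orientation_eq (hS c hc)] at h2
    rw [← (hS c hc).orientation_eq (hS a ha)] at h3
    refine (isEmbracingSet_triangle p _ _ _ h1 h2 h3).mono ?_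
    rintro _ (rfl | rfl | rfl)
    exacts [mem_image_of_mem _ ha, mem_image_of_mem _ hb, mem_image_of_mem _ hc]
  | cross a m b v =>
    obtain ⟨ha, hm, hb, hv, hab, hab', ham, hmv, hmv'⟩ := hK
    obtain ⟨h2, h3, h4⟩ := Source.cross_signs_of_opposite hab hab' ham hmv hmv'
    rw [← (hS a ha).orientation_eq (hS m hm)] at ham
    rw [← (hS m hm).orientation_eq (hS b hb)] at h2
    rw [← (hS b hb).orientation_eq (hS v hv)] at h3
    rw [← (hS v hv).orientation_eq (hS a ha)] at h4
    refine (isEmbracingSet_quadrilateral p _ _ _ _ ham h2 h3 h4).mono ?_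
    rintro _ (rfl | rfl | rfl | rfl)
    exacts [mem_image_of_mem _ ha, mem_image_of_mem _ hm, mem_image_of_mem _ hb,
      mem_image_of_mem _ hv]
  | empty => exact hfull.elim
  | ray => exact hfull.elim
  | line => exact hfull.elim
  | wedge => exact hfull.elim
  | halfPlane => exact hfull.elim

theorem Fan.Represents.full_iff {K : Fan} {S : Set Source} {p : Plane}
    (hK : K.Represents S) (hS : ∀ u ∈ S, u.SeenFrom p) :
    K.Full ↔ IsEmbracingSet (Source.site '' S) p :=
  ⟨hK.isEmbracingSet hS, fun h => by_contra fun hf => hK.not_isEmbracingSet hS hf h⟩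

section

open Source

/-- The signs of `v` against the remembered sources locate it relative to the old cone. The old
elements of `S` satisfy the new conditions because their determinants with `v` are combinations of
known ones. The hypothesis on `v.d` matters only for the empty fan, which tests the distance rather
than the coordinates. -/
theorem Fan.Represents.extend {K : Fan} {S : Set Source} (hK : K.Represents S) {v : Source}
    (hv : 0 < v.d ↔ v.x ≠ 0 ∨ v.y ≠ 0) : (K.extend v).val.Represents (insert v S) := by
  cases K with
  | empty =>
    by_cases h : 0 < v.d
    · simp only [Fan.extend, Timed.val_bind, ltR, val_prim, h, decide_true, if_true, Timed.val_pure]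
      refine ⟨mem_insert _ _, inner_self_pos (hv.mp h), ?_⟩
      rw [forall_mem_insert]
      exact ⟨⟨cross_self v, inner_self_nonneg v⟩, fun u hu => by
        simp [Source.cross, Source.inner, (hK u hu).1, (hK u hu).2]⟩
    · simp only [Fan.extend, Timed.val_bind, ltR, val_prim, h, decide_false, Bool.false_eq_true,
        if_false, Timed.val_pure]
      rw [hv, not_or, not_ne_iff, not_ne_iff] at h
      rw [Represents, forall_mem_insert]
      exact ⟨h, hK⟩
  | ray a =>
    obtain ⟨ha, haa, hS⟩ := hK
    have haS := mem_insert_of_mem v ha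
    have hvS := mem_insert v S
    -- Every `u` in `S` is a nonnegative multiple of `a`, so its determinant with `v` is that
    -- multiple of `a.cross v`.
    have key : ∀ u ∈ S, a.inner a * u.cross v = a.inner u * a.cross v := fun u hu => by
      rw [inner_self_mul_cross, (hS u hu).1, mul_zero, sub_zero]
    rcases lt_trichotomy 0 (a.cross v) with h1 | h1 | h2
    · have e : ((Fan.ray a).extend v).val = .wedge a v := by simp [Fan.extend, h1]
      rw [e]
      refine ⟨haS, hvS, h1, ?_⟩
      rw [forall_mem_insert]
      refine ⟨⟨h1.le, (cross_self v).ge⟩, fun u hu => ⟨(hS u hu).1.ge, ?_⟩⟩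
      refine nonneg_of_mul_nonneg_right (a := a.inner a) ?_ haa
      rw [key u hu]
      exact mul_nonneg (hS u hu).2 h1.le
    · have h0 := h1.symm
      rcases lt_or_ge (a.inner v) 0 with h3 | h3
      · have e : ((Fan.ray a).extend v).val = .line a v := by simp [Fan.extend, h0, h3]
        rw [e]
        refine ⟨haS, hvS, h0, h3, ?_⟩
        rw [forall_mem_insert]
        exact ⟨h0, fun u hu => (hS u hu).1⟩
      · have e : ((Fan.ray a).extend v).val = .ray a := by simp [Fan.extend, h0, h3.not_gt]
        rw [e]
        refine ⟨haS, haa, ?_⟩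
        rw [forall_mem_insert]
        exact ⟨⟨h0, h3⟩, hS⟩
    · have e : ((Fan.ray a).extend v).val = .wedge v a := by
        simp [Fan.extend, h2, h2.not_gt]
      rw [e]
      refine ⟨hvS, haS, by rw [cross_swap]; linarith, ?_⟩
      rw [forall_mem_insert]
      refine ⟨⟨(cross_self v).ge, by rw [cross_swap]; linarith⟩, fun u hu => ⟨?_, ?_⟩⟩
      · refine nonneg_of_mul_nonneg_right (a := a.inner a) ?_ haa
        rw [cross_swap, mul_neg, key u hu, ← mul_neg]
        exact mul_nonneg (hS u hu).2 (by linarith)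
      · rw [cross_swap, (hS u hu).1, neg_zero]
  | line a b =>
    obtain ⟨ha, hb, hab, hab', hS⟩ := hK
    have haS := mem_insert_of_mem v ha
    have hbS := mem_insert_of_mem v hb
    have hvS := mem_insert v S
    have haa := inner_self_pos (ne_zero_of_inner_ne hab'.ne)
    have key : ∀ u, a.inner a * b.cross u = a.inner b * a.cross u := fun u => by
      rw [inner_self_mul_cross, hab, mul_zero, sub_zero]
    rcases lt_trichotomy (a.cross v) 0 with h2 | h1 | h1
    rotate_left 2
    · have e : ((Fan.line a b).extend v).val = .halfPlane a v b := by simp [Fan.extend, h1]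
      rw [e]
      refine ⟨haS, hvS, hbS, hab, hab', h1, ?_⟩
      rw [forall_mem_insert]
      exact ⟨h1.le, fun u hu => (hS u hu).ge⟩
    -- As `b` points opposite to `a`, exchanging them puts `v` on the left.
    · have e : ((Fan.line a b).extend v).val = .halfPlane b v a := by
        simp [Fan.extend, h2, h2.not_gt]
      rw [e]
      have h3 : 0 < b.cross v := by
        refine pos_of_mul_pos_right (a := a.inner a) ?_ haa.le
        rw [key]
        exact mul_pos_of_neg_of_neg hab' h2
      refine ⟨hbS, hvS, haS, by rw [cross_swap, hab, neg_zero], by rwa [inner_comm], h3, ?_⟩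
      rw [forall_mem_insert]
      refine ⟨h3.le, fun u hu => nonneg_of_mul_nonneg_right (a := a.inner a) ?_ haa⟩
      rw [key, hS u hu, mul_zero]
    · have e : ((Fan.line a b).extend v).val = .line a b := by simp [Fan.extend, h1]
      rw [e]
      refine ⟨haS, hbS, hab, hab', ?_⟩
      rw [forall_mem_insert]
      exact ⟨h1, hS⟩
  | wedge a b =>
    obtain ⟨ha, hb, hab, hS⟩ := hK
    have haS := mem_insert_of_mem v ha
    have hbS := mem_insert_of_mem v hb
    have hvS := mem_insert v S
    have key : ∀ u, a.cross b * u.cross v = a.cross u * b.cross v - a.cross v * b.cross u :=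
      fun u => cross_mul_cross a b u v
    have hba := cross_swap b a
    have hvb := cross_swap v b
    have hva := cross_swap v a
    have hbb := inner_self_pos (ne_zero_of_cross_ne (u := b) (v := a) (by linarith))
    have haa := inner_self_pos (ne_zero_of_cross_ne hab.ne')
    -- Up to the positive factor `a.cross b`, the numbers `v.cross b` and `a.cross v` are the
    -- coordinates of `v` in the basis `a`, `b`. Both negative: `v` is inside the opposite wedge,
    -- and the cone becomes the plane. One zero and the other negative: `v` is opposite to `b` or to
    -- `a`, giving a half-plane. Opposite strict signs: the wedge widens. Both nonnegative: nothing
    -- changes.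
    rcases lt_trichotomy (a.cross v) 0 with h1 | h1 | h1 <;>
    rcases lt_trichotomy (v.cross b) 0 with h2 | h2 | h2
    · have e : ((Fan.wedge a b).extend v).val = .triangle a b v := by simp [Fan.extend, h1, h2]
      rw [e]
      exact ⟨haS, hbS, hvS, hab, by linarith, by linarith⟩
    · have e : ((Fan.wedge a b).extend v).val = .halfPlane v a b := by simp [Fan.extend, h1, h2]
      rw [e]
      have h3 : v.inner b < 0 := by
        have := inner_self_mul_cross b v a
        rw [inner_comm b v, show b.cross v = 0 by linarith, mul_zero, sub_zero] at this
        have h4 : 0 < v.inner b * b.cross a := by rw [← this]; exact mul_pos hbb (by linarith)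
        by_contra! h5
        nlinarith
      refine ⟨hvS, haS, hbS, h2, h3, by linarith, ?_⟩
      rw [forall_mem_insert]
      refine ⟨(cross_self v).ge, fun u hu => nonneg_of_mul_nonneg_right (a := a.cross b) ?_ hab⟩
      have h4 := (hS u hu).2
      have h5 := cross_swap u b
      rw [cross_mul_cross, show b.cross v = 0 by linarith, mul_zero, sub_zero]
      exact mul_nonneg_of_nonpos_of_nonpos h1.le (by linarith)
    · have e : ((Fan.wedge a b).extend v).val = .wedge v b := by
        simp [Fan.extend, h1, h2, h2.not_gt]
      rw [e]
      refine ⟨hvS, hbS, h2, ?_⟩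
      rw [forall_mem_insert]
      refine ⟨⟨(cross_self v).ge, h2.le⟩, fun u hu =>
        ⟨nonneg_of_mul_nonneg_right (a := a.cross b) ?_ hab, (hS u hu).2⟩⟩
      obtain ⟨h3, h4⟩ := hS u hu
      have h5 := cross_swap u b
      rw [cross_mul_cross]
      have := mul_nonneg_of_nonpos_of_nonpos h1.le (show b.cross u ≤ 0 by linarith)
      have := mul_nonneg h3 h2.le
      rw [hvb] at this
      linarith
    · have e : ((Fan.wedge a b).extend v).val = .halfPlane a b v := by simp [Fan.extend, h1, h2]
      rw [e]
      have h3 : a.inner v < 0 := by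
        have := inner_self_mul_cross a v b
        rw [h1, mul_zero, sub_zero] at this
        have h4 : a.inner v * a.cross b < 0 := by
          rw [← this]; exact mul_neg_of_pos_of_neg haa h2
        exact neg_of_mul_neg_left h4 hab.le
      refine ⟨haS, hbS, hvS, h1, h3, hab, ?_⟩
      rw [forall_mem_insert]
      exact ⟨h1.ge, fun u hu => (hS u hu).1⟩
    · have e : ((Fan.wedge a b).extend v).val = .wedge a b := by simp [Fan.extend, h1, h2]
      rw [e]
      refine ⟨haS, hbS, hab, ?_⟩
      rw [forall_mem_insert]
      exact ⟨⟨h1.ge, h2.ge⟩, hS⟩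
    · have e : ((Fan.wedge a b).extend v).val = .wedge a b := by
        simp [Fan.extend, h1, h2.not_gt]
      rw [e]
      refine ⟨haS, hbS, hab, ?_⟩
      rw [forall_mem_insert]
      exact ⟨⟨h1.ge, h2.le⟩, hS⟩
    · have e : ((Fan.wedge a b).extend v).val = .wedge a v := by
        simp [Fan.extend, h1, h1.not_gt, h2]
      rw [e]
      refine ⟨haS, hvS, h1, ?_⟩
      rw [forall_mem_insert]
      refine ⟨⟨h1.le, (cross_self v).ge⟩, fun u hu =>
        ⟨(hS u hu).1, nonneg_of_mul_nonneg_right (a := a.cross b) ?_ hab⟩⟩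
      obtain ⟨h3, h4⟩ := hS u hu
      have h5 := cross_swap u b
      rw [key]
      have := mul_nonneg h3 (show 0 ≤ b.cross v by linarith)
      have := mul_nonneg h1.le h4
      rw [h5] at this
      linarith
    · have e : ((Fan.wedge a b).extend v).val = .wedge a b := by
        simp [Fan.extend, h1.not_gt, h2]
      rw [e]
      refine ⟨haS, hbS, hab, ?_⟩
      rw [forall_mem_insert]
      exact ⟨⟨h1.le, h2.ge⟩, hS⟩
    · have e : ((Fan.wedge a b).extend v).val = .wedge a b := by
        simp [Fan.extend, h1.not_gt, h2.not_gt]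
      rw [e]
      refine ⟨haS, hbS, hab, ?_⟩
      rw [forall_mem_insert]
      exact ⟨⟨h1.le, h2.le⟩, hS⟩
  | halfPlane a m b =>
    obtain ⟨ha, hm, hb, hab, hab', ham, hS⟩ := hK
    have haS := mem_insert_of_mem v ha
    have hmS := mem_insert_of_mem v hm
    have hbS := mem_insert_of_mem v hb
    have hvS := mem_insert v S
    have haa := inner_self_pos (ne_zero_of_inner_ne hab'.ne)
    have hvm := cross_swap v m
    have hva := cross_swap v a
    have hmb : a.inner a * m.cross b = -(a.inner b * a.cross m) := by
      rw [inner_self_mul_cross, hab, mul_zero, zero_sub]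
    have hbv : a.inner a * b.cross v = a.inner b * a.cross v := by
      rw [inner_self_mul_cross, hab, mul_zero, sub_zero]
    rcases lt_or_ge (a.cross v) 0 with h1 | h1
    -- Now `v` is strictly beyond the bounding line. Unless it is exactly opposite to `m`, it forms
    -- a triangle with `m` and one of the two boundary rays.
    · rcases lt_trichotomy (v.cross m) 0 with h2 | h2 | h2
      · have e : ((Fan.halfPlane a m b).extend v).val = .triangle a m v := by
          simp [Fan.extend, h1, h2, h2.not_gt]
        rw [e]
        exact ⟨haS, hmS, hvS, ham, by linarith, by linarith⟩
      · have e : ((Fan.halfPlane a m b).extend v).val = .cross a m b v := by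
          simp [Fan.extend, h1, h2]
        rw [e]
        have hmm := inner_self_pos (ne_zero_of_cross_ne (u := m) (v := a)
          (by rw [cross_swap]; linarith))
        have h3 : m.inner v * a.cross m = m.inner m * a.cross v := by
          have := inner_self_mul_cross m v a
          rw [show m.cross v = 0 by linarith, mul_zero, sub_zero, hva, cross_swap m a] at this
          linarith
        refine ⟨haS, hmS, hbS, hvS, hab, hab', ham, by linarith, ?_⟩
        refine neg_of_mul_neg_left (b := a.cross m) ?_ ham.le
        rw [h3]
        exact mul_neg_of_pos_of_neg hmm h1
      · have e : ((Fan.halfPlane a m b).extend v).val = .triangle m b v := by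
          simp [Fan.extend, h1, h2]
        rw [e]
        refine ⟨hmS, hbS, hvS, ?_, ?_, h2⟩
        · refine pos_of_mul_pos_right (a := a.inner a) ?_ haa.le
          rw [hmb]
          linarith [mul_neg_of_neg_of_pos hab' ham]
        · refine pos_of_mul_pos_right (a := a.inner a) ?_ haa.le
          rw [hbv]
          exact mul_pos_of_neg_of_neg hab' h1
    · have e : ((Fan.halfPlane a m b).extend v).val = .halfPlane a m b := by
        simp [Fan.extend, h1.not_gt]
      rw [e]
      refine ⟨haS, hmS, hbS, hab, hab', ham, ?_⟩
      rw [forall_mem_insert]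
      exact ⟨h1, hS⟩
  | triangle a b c =>
    obtain ⟨ha, hb, hc, h⟩ := hK
    exact ⟨mem_insert_of_mem v ha, mem_insert_of_mem v hb, mem_insert_of_mem v hc, h⟩
  | cross a m b w =>
    obtain ⟨ha, hm, hb, hw, h⟩ := hK
    exact ⟨mem_insert_of_mem v ha, mem_insert_of_mem v hm, mem_insert_of_mem v hb,
      mem_insert_of_mem v hw, h⟩

end

/-- A full fan spans the whole plane and puts no condition on the other sources. This allows adding
one source at a time to stop early. -/
theorem Fan.Represents.of_subset_of_full {K : Fan} {S T : Set Source} (hK : K.Represents S)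
    (hfull : K.Full) (hST : S ⊆ T) : K.Represents T := by
  cases K with
  | triangle a b c => exact ⟨hST hK.1, hST hK.2.1, hST hK.2.2.1, hK.2.2.2⟩
  | cross a m b v =>
    exact ⟨hST hK.1, hST hK.2.1, hST hK.2.2.1, hST hK.2.2.2.1, hK.2.2.2.2⟩
  | empty => exact hfull.elim
  | ray => exact hfull.elim
  | line => exact hfull.elim
  | wedge => exact hfull.elim
  | halfPlane => exact hfull.elim

theorem Fan.Represents.extendAll {p : Plane} {K : Fan} {S : Set Source} (hK : K.Represents S)
    (l : List Source) (hl : ∀ u ∈ l, u.SeenFrom p) :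
    (K.extendAll l).val.Represents (S ∪ {u | u ∈ l}) := by
  induction l generalizing K S with
  | nil => simpa [Fan.extendAll] using hK
  | cons v l ih =>
    rw [List.forall_mem_cons] at hl
    have e : S ∪ {u | u ∈ v :: l} = insert v S ∪ {u | u ∈ l} := by
      ext u; simp only [mem_union, mem_ofPred_eq, List.mem_cons, mem_insert_iff]; tauto
    rw [e]
    exact ih (hK.extend hl.1.pos_iff) hl.2

theorem Fan.time_extendAll_le (K : Fan) (l : List Source) :
    (K.extendAll l).time ≤ 13 * l.length + 1 := by
  induction l generalizing K with
  | nil => simp [Fan.extendAll]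
  | cons v l ih =>
    have h1 := K.time_extend_le v
    have h2 := ih (K.extend v).val
    simp only [Fan.extendAll, Timed.time_bind, time_step, List.length_cons]
    omega

theorem Fan.complete_cons_of_full (K : Fan) (v : Source) (l : List Source)
    (h : (K.extend v).val.Full) :
    (K.complete (v :: l)).val = (some v, (K.extend v).val) ∧ (K.complete (v :: l)).time ≤ 14 := by
  have h1 := K.time_extend_le v
  rw [← Fan.val_isFull] at h
  simp only [Fan.complete, Timed.val_bind, Timed.time_bind, h, if_true, Timed.val_pure,
    Timed.time_pure, time_step, Fan.time_isFull, true_and]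
  omega

theorem Fan.complete_cons_of_not_full (K : Fan) (v : Source) (l : List Source)
    (h : ¬ (K.extend v).val.Full) :
    (K.complete (v :: l)).val = ((K.extend v).val.complete l).val ∧
      (K.complete (v :: l)).time ≤ 14 + ((K.extend v).val.complete l).time := by
  have h1 := K.time_extend_le v
  rw [← Fan.val_isFull] at h
  simp only [Fan.complete, Timed.val_bind, Timed.time_bind, h, Bool.false_eq_true, if_false,
    time_step, Fan.time_isFull, true_and]
  omega

theorem Fan.time_complete_le (K : Fan) (l : List Source) :
    (K.complete l).time ≤ 14 * l.length + 1 := by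
  induction l generalizing K with
  | nil => simp [Fan.complete]
  | cons v l ih =>
    rw [List.length_cons]
    by_cases h : (K.extend v).val.Full
    · have := (K.complete_cons_of_full v l h).2
      omega
    · have h1 := (K.complete_cons_of_not_full v l h).2
      have h2 := ih (K.extend v).val
      omega

/-- Even after an early stop the fan represents the unread sources too, since it is then full. -/
theorem Fan.Represents.complete {p : Plane} {K : Fan} {S : Set Source} (hK : K.Represents S)
    (hfull : ¬ K.Full) (l : List Source) (hl : ∀ u ∈ l, u.SeenFrom p) :
    (K.complete l).val.2.Represents (S ∪ {u | u ∈ l}) ∧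
      ((K.complete l).val.1 = none → ¬ (K.complete l).val.2.Full) ∧
      ∀ f, (K.complete l).val.1 = some f → f ∈ l ∧ (K.complete l).val.2.Full := by
  induction l generalizing K S with
  | nil => simpa [Fan.complete] using ⟨hK, hfull⟩
  | cons v l ih =>
    rw [List.forall_mem_cons] at hl
    have e : S ∪ {u | u ∈ v :: l} = insert v S ∪ {u | u ∈ l} := by
      ext u; simp only [mem_union, mem_ofPred_eq, List.mem_cons, mem_insert_iff]; tauto
    have hKv := hK.extend hl.1.pos_iff
    rw [e]
    by_cases h : (K.extend v).val.Full
    · rw [(K.complete_cons_of_full v l h).1]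
      refine ⟨hKv.of_subset_of_full h subset_union_left, by simp, ?_⟩
      rintro f hf
      cases hf
      exact ⟨List.mem_cons_self, h⟩
    · rw [(K.complete_cons_of_not_full v l h).1]
      obtain ⟨h1, h2, h3⟩ := ih hKv h hl.2
      exact ⟨h1, h2, fun f hf => ⟨List.mem_cons_of_mem _ (h3 f hf).1, (h3 f hf).2⟩⟩

/-! ### The halving search -/

@[simp] theorem val_distances (l : List Source) : (distances l).val = l.map Source.d := by
  induction l with
  | nil => simp [distances]
  | cons u l ih => simp [distances, ih]

@[simp] theorem time_distances (l : List Source) : (distances l).time = 2 * l.length + 1 := by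
  induction l with
  | nil => simp [distances]
  | cons u l ih => simp [distances, ih]; omega

open Classical in
-- One round of the search, its outcome and cost separated into the three possible branches.
-- Selection accounts for 1000 of the 1040 steps per candidate.
theorem search_succ (depth : ℕ) (K : Fan) (l : List Source) (hl : l ≠ []) :
    ∃ m, HasRank (l.map Source.d) (l.length / 2) m ∧
      ∀ near mid far K₁, near = l.filter (fun u => u.d < m) → mid = l.filter (fun u => u.d = m) →
        far = l.filter (fun u => m < u.d) → K₁ = (K.extendAll near).val →
      (K₁.Full → (search (depth + 1) K l).val = (search depth K near).val ∧
        (search (depth + 1) K l).time ≤ 1040 * l.length + 20 + (search depth K near).time) ∧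
      (¬ K₁.Full →
        (∀ f K₂, (K₁.complete mid).val = (some f, K₂) →
          (search (depth + 1) K l).val = some (f, K₂) ∧
          (search (depth + 1) K l).time ≤ 1040 * l.length + 20) ∧
        (∀ K₂, (K₁.complete mid).val = (none, K₂) →
          (search (depth + 1) K l).val = (search depth K₂ far).val ∧
          (search (depth + 1) K l).time ≤ 1040 * l.length + 20 + (search depth K₂ far).time)) := by
  have hpos := List.length_pos_iff.mpr hl
  obtain ⟨h1, h2⟩ := select_spec l.length (l.length / 2) (l.map Source.d) (by simp)
    (by rw [List.length_map]; omega)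
  rw [List.length_map] at h2
  refine ⟨_, h1, ?_⟩
  rintro _ _ _ _ rfl rfl rfl rfl
  obtain ⟨u, us, rfl⟩ := List.exists_cons_of_ne_nil hl
  set l := u :: us with hl'
  set m := (select l.length (l.length / 2) (l.map Source.d)).val with hm
  have t1 := time_split_le Source.d m l
  have t2 := K.time_extendAll_le (l.filter (fun u => u.d < m))
  have t3 := (K.extendAll (l.filter (fun u => u.d < m))).val.time_complete_le
    (l.filter (fun u => u.d = m))
  have t4 := List.length_filter_le (fun u => decide (u.d < m)) l
  have t5 := List.length_filter_le (fun u => decide (u.d = m)) l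
  rw [← Fan.val_isFull]
  have unfold_search : search (depth + 1) K l = (do
      step
      let l ← consL u us
      let n ← len l
      let h ← halfN n
      let ds ← distances l
      let m ← select n h ds
      let (near, mid, far) ← split Source.d m l
      let K₁ ← K.extendAll near
      if ← K₁.isFull then
        search depth K near
      else
        let (found, K₂) ← K₁.complete mid
        match found with
        | some f => prim (some (f, K₂))
        | none => search depth K₂ far) := rfl
  rw [unfold_search]
  simp only [Timed.val_bind, Timed.time_bind, consL, val_prim, time_prim, ← hl', val_len,
    time_len, halfN, val_distances, time_distances, ← hm, val_split, time_step, Fan.time_isFull]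
  refine ⟨fun hf => ?_, fun hf => ⟨fun f K₂ hc => ?_, fun K₂ hc => ?_⟩⟩
  · simp only [hf, if_true, true_and]
    omega
  · simp only [hf, Bool.false_eq_true, if_false, Timed.val_bind, Timed.time_bind, hc, val_prim,
      time_prim, true_and]
    omega
  · simp only [hf, Bool.false_eq_true, if_false, Timed.val_bind, Timed.time_bind, hc, true_and]
    omega

open Classical in
theorem length_filter_le_of_hasRank (l : List Source) (hl : l ≠ []) (m : ℝ)
    (h : HasRank (l.map Source.d) (l.length / 2) m) :
    (l.filter (fun u => u.d < m)).length ≤ l.length / 2 ∧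
      (l.filter (fun u => m < u.d)).length ≤ l.length / 2 := by
  have hpos := List.length_pos_iff.mpr hl
  obtain ⟨h1, h2⟩ := h
  have h3 := countP_eq_add_countP_filter_gt (fun _ => true) m (l.map Source.d) (fun _ _ => rfl)
  simp only [List.countP_true, List.length_map, List.filter_map] at h3
  rw [List.countP_map, List.countP_eq_length_filter] at h1
  simp only [Function.comp_def] at h1 h3
  exact ⟨h1, by omega⟩

/-- Each round passes on at most half of the candidates, so the rate is essentially twice the 1040
of one round, with a margin for the additive constant. -/
theorem time_search_le (depth : ℕ) (K : Fan) (l : List Source) :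
    (search depth K l).time ≤ 2120 * l.length + 1 := by
  classical
  induction depth generalizing K l with
  | zero => simp [search]
  | succ depth ih =>
    by_cases hl : l = []
    · subst hl; simp [search]
    have hpos := List.length_pos_iff.mpr hl
    obtain ⟨m, hm, h⟩ := search_succ depth K l hl
    obtain ⟨hnear, hfar⟩ := length_filter_le_of_hasRank l hl m hm
    obtain ⟨hf, hnf⟩ := h _ _ _ _ rfl rfl rfl rfl
    by_cases hfull : (K.extendAll (l.filter (fun u => u.d < m))).val.Full
    · have h1 := (hf hfull).2
      have h2 := ih K (l.filter (fun u => u.d < m))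
      omega
    · obtain ⟨hsome, hnone⟩ := hnf hfull
      rcases hc : ((K.extendAll (l.filter (fun u => u.d < m))).val.complete
        (l.filter (fun u => u.d = m))).val with ⟨_ | f, K₂⟩
      · have h1 := (hnone K₂ hc).2
        have h2 := ih K₂ (l.filter (fun u => m < u.d))
        omega
      · have h1 := (hsome f K₂ hc).2
        omega

/-- Invariant: `K` is not full and represents the sources `S` already discarded as too close, all
strictly closer than the candidates. Since a recursive call sees only part of the candidates, its
conclusion has to be transferred to all of them. -/
theorem search_spec {p : Plane} (depth : ℕ) (K : Fan) (S : Set Source) (l : List Source)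
    (hdepth : l.length < depth) (hK : K.Represents S) (hfull : ¬ K.Full)
    (hlt : ∀ s ∈ S, ∀ u ∈ l, s.d < u.d) (hS : ∀ u ∈ S, u.SeenFrom p)
    (hl : ∀ u ∈ l, u.SeenFrom p) :
    ((search depth K l).val = none →
      ¬ IsEmbracingSet (Source.site '' (S ∪ {u | u ∈ l})) p) ∧
    ∀ f K', (search depth K l).val = some (f, K') → f ∈ l ∧ K'.Full ∧
      K'.Represents {u | u ∈ S ∪ {u | u ∈ l} ∧ u.d ≤ f.d} ∧
      ¬ IsEmbracingSet (Source.site '' {u | u ∈ S ∪ {u | u ∈ l} ∧ u.d < f.d}) p := by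
  classical
  induction depth generalizing K S l with
  | zero => omega
  | succ depth ih =>
    by_cases hnil : l = []
    · subst hnil
      simpa [search] using hK.not_isEmbracingSet hS hfull
    have hpos := List.length_pos_iff.mpr hnil
    obtain ⟨m, hm, h⟩ := search_succ depth K l hnil
    obtain ⟨hnear, hfar⟩ := length_filter_le_of_hasRank l hnil m hm
    obtain ⟨hf, hnf⟩ := h _ _ _ _ rfl rfl rfl rfl
    set near := l.filter (fun u => u.d < m) with hnear_def
    set mid := l.filter (fun u => u.d = m) with hmid_def
    set far := l.filter (fun u => m < u.d) with hfar_def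
    have mem_near : ∀ u, u ∈ near ↔ u ∈ l ∧ u.d < m := fun u => by simp [hnear_def]
    have mem_mid : ∀ u, u ∈ mid ↔ u ∈ l ∧ u.d = m := fun u => by simp [hmid_def]
    have mem_far : ∀ u, u ∈ far ↔ u ∈ l ∧ m < u.d := fun u => by simp [hfar_def]
    have near_seen : ∀ u ∈ near, u.SeenFrom p := fun u hu => hl u ((mem_near u).mp hu).1
    have mid_seen : ∀ u ∈ mid, u.SeenFrom p := fun u hu => hl u ((mem_mid u).mp hu).1
    have hK₁ := hK.extendAll near near_seen
    have hS₁ : ∀ u ∈ S ∪ {u | u ∈ near}, u.SeenFrom p := by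
      rintro u (hu | hu)
      exacts [hS u hu, near_seen u hu]
    by_cases hfull₁ : (K.extendAll near).val.Full
    · rw [(hf hfull₁).1]
      obtain ⟨ih1, ih2⟩ := ih K S near (by omega) hK hfull
        (fun s hs u hu => hlt s hs u ((mem_near u).mp hu).1) hS near_seen
      -- Failure in the closer half is impossible, as this half together with `S` embraces `p`. The
      -- site found has distance less than `m`, so the sources strictly closer than it are all in
      -- `S` or the closer half.
      refine ⟨fun hn => (ih1 hn (hK₁.isEmbracingSet hS₁ hfull₁)).elim, fun f K' hfK => ?_⟩
      obtain ⟨hfn, hK'f, hK', hnot⟩ := ih2 f K' hfK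
      obtain ⟨hfl, hfm⟩ := (mem_near f).mp hfn
      refine ⟨hfl, hK'f, hK'.of_subset_of_full hK'f ?_, fun he => hnot (he.mono ?_)⟩
      · rintro u ⟨hu | hu, hd⟩
        exacts [⟨Or.inl hu, hd⟩, ⟨Or.inr ((mem_near u).mp hu).1, hd⟩]
      · refine image_mono ?_
        rintro u ⟨hu | hu, hd⟩
        exacts [⟨Or.inl hu, hd⟩, ⟨Or.inr ((mem_near u).mpr ⟨hu, hd.trans hfm⟩), hd⟩]
    · obtain ⟨hsome, hnone⟩ := hnf hfull₁
      obtain ⟨hc1, hc2, hc3⟩ := hK₁.complete hfull₁ mid mid_seen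
      rcases hc : ((K.extendAll near).val.complete mid).val with ⟨_ | f, K₂⟩
      · rw [hc] at hc1 hc2
        rw [(hnone K₂ hc).1]
        have e : S ∪ {u | u ∈ near} ∪ {u | u ∈ mid} ∪ {u | u ∈ far} = S ∪ {u | u ∈ l} := by
          ext u
          simp only [mem_union, mem_ofPred_eq, mem_near, mem_mid, mem_far]
          have := lt_trichotomy u.d m
          tauto
        have hS₂ : ∀ u ∈ S ∪ {u | u ∈ near} ∪ {u | u ∈ mid}, u.SeenFrom p := by
          rintro u (hu | hu)
          exacts [hS₁ u hu, mid_seen u hu]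
        obtain ⟨ih1, ih2⟩ := ih K₂ _ far (by omega) hc1 (hc2 rfl) (by
          rintro s ((hs | hs) | hs) u hu
          · exact hlt s hs u ((mem_far u).mp hu).1
          · exact ((mem_near s).mp hs).2.trans ((mem_far u).mp hu).2
          · exact ((mem_mid s).mp hs).2.trans_lt ((mem_far u).mp hu).2) hS₂
          (fun u hu => hl u ((mem_far u).mp hu).1)
        rw [e] at ih1 ih2
        refine ⟨ih1, fun f K' hfK => ?_⟩
        obtain ⟨h1, h2⟩ := ih2 f K' hfK
        exact ⟨((mem_far f).mp h1).1, h2⟩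
      · rw [hc] at hc1 hc3
        rw [(hsome f K₂ hc).1]
        refine ⟨by simp, ?_⟩
        rintro _ _ ⟨⟩
        obtain ⟨hfm, hK₂⟩ := hc3 f rfl
        obtain ⟨hfl, hfd⟩ := (mem_mid f).mp hfm
        -- The completing source is at distance `m`, and the candidates strictly closer are exactly
        -- the closer half, already known not to embrace `p` with `S`.
        refine ⟨hfl, hK₂, hc1.of_subset_of_full hK₂ ?_, fun he =>
          hK₁.not_isEmbracingSet hS₁ hfull₁ (he.mono (image_mono ?_))⟩
        · rintro u ((hu | hu) | hu)
          · exact ⟨Or.inl hu, (hlt u hu f hfl).le⟩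
          · exact ⟨Or.inr ((mem_near u).mp hu).1, by rw [hfd]; exact ((mem_near u).mp hu).2.le⟩
          · exact ⟨Or.inr ((mem_mid u).mp hu).1, by rw [hfd, ((mem_mid u).mp hu).2]⟩
        · rintro u ⟨hu | hu, hd⟩
          exacts [Or.inl hu, Or.inr ((mem_near u).mpr ⟨hu, hfd ▸ hd⟩)]

/-! ### Degenerate triples and opposite rays -/

/-- Some line through `p` contains `A` and `B`; on whichever side `C` lies, one closed half-plane of
that line contains all three. -/
theorem not_isEmbracingSet_triple_of_orientation_eq_zero (p A B C : Plane)
    (h : orientation p A B = 0) : ¬ IsEmbracingSet {A, B, C} p := by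
  obtain ⟨w₀, w₁, hw, hA, hB⟩ : ∃ w₀ w₁ : ℝ, (w₀ ≠ 0 ∨ w₁ ≠ 0) ∧
      w₀ * (A 0 - p 0) + w₁ * (A 1 - p 1) = 0 ∧ w₀ * (B 0 - p 0) + w₁ * (B 1 - p 1) = 0 := by
    unfold orientation at h
    by_cases hA : A 0 - p 0 = 0 ∧ A 1 - p 1 = 0
    · by_cases hB : B 0 - p 0 = 0 ∧ B 1 - p 1 = 0
      · exact ⟨1, 0, by simp, by simp [hA], by simp [hB]⟩
      · exact ⟨B 1 - p 1, -(B 0 - p 0), by rw [neg_ne_zero]; tauto, by simp [hA], by ring⟩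
    · exact ⟨A 1 - p 1, -(A 0 - p 0), by rw [neg_ne_zero]; tauto, by ring, by linarith⟩
  rcases le_total (w₀ * (C 0 - p 0) + w₁ * (C 1 - p 1)) 0 with hC | hC
  · refine not_isEmbracingSet_of_forall_le _ p w₀ w₁ hw ?_
    rintro _ (rfl | rfl | rfl)
    exacts [hA.le, hB.le, hC]
  · refine not_isEmbracingSet_of_forall_le _ p (-w₀) (-w₁) (by simpa using hw) ?_
    rintro _ (rfl | rfl | rfl) <;> linarith

theorem IsEmbracingSet.orientation_ne_zero {p A B C : Plane} (h : IsEmbracingSet {A, B, C} p) :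
    orientation p A B ≠ 0 ∧ orientation p B C ≠ 0 ∧ orientation p A C ≠ 0 := by
  refine ⟨fun h0 => not_isEmbracingSet_triple_of_orientation_eq_zero p A B C h0 h,
    fun h0 => not_isEmbracingSet_triple_of_orientation_eq_zero p B C A h0 ?_,
    fun h0 => not_isEmbracingSet_triple_of_orientation_eq_zero p A C B h0 ?_⟩
  · convert h using 1; ext; simp; tauto
  · convert h using 1; ext; simp; tauto

theorem IsEmbracingSet.ncard_triple {p A B C : Plane} (h : IsEmbracingSet {A, B, C} p) :
    ({A, B, C} : Set Plane).ncard = 3 := by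
  have self : ∀ A, orientation p A A = 0 := fun A => by unfold orientation; ring
  obtain ⟨h1, h2, h3⟩ := h.orientation_ne_zero
  refine ncard_eq_three.mpr ⟨A, B, C, ?_, ?_, ?_, rfl⟩ <;> rintro rfl
  exacts [h1 (self _), h3 (self _), h2 (self _)]

/-- A hull with interior points spans the plane, which has dimension 2. -/
theorem IsEmbracingSet.not_collinear {G : Set Plane} {p : Plane} (h : IsEmbracingSet G p) :
    ¬ Collinear ℝ G := by
  intro hc
  have h1 := interior_convexHull_nonempty_iff_affineSpan_eq_top.mp ⟨p, h⟩
  have h2 := AffineSubspace.vectorSpan_eq_top_of_affineSpan_eq_top ℝ Plane Plane h1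
  have h3 := collinear_iff_finrank_le_one.mp hc
  rw [h2, finrank_top, finrank_euclideanSpace_fin] at h3
  omega

/-- Parallelism gives `(a·a) b = (a·b) a`, so the positive weights `-(a·b)` and `a·a` on `a` and `b`
cancel the displacements; dividing by their sum gives the convex combination. -/
theorem mem_openSegment_of_opposite {p : Plane} {a b : Source} (ha : a.SeenFrom p)
    (hb : b.SeenFrom p) (hab : a.cross b = 0) (hab' : a.inner b < 0) :
    p ∈ openSegment ℝ a.site b.site := by
  have haa := Source.inner_self_pos (Source.ne_zero_of_inner_ne hab'.ne)
  have hs : 0 < a.inner a - a.inner b := by linarith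
  refine ⟨-a.inner b / (a.inner a - a.inner b), a.inner a / (a.inner a - a.inner b),
    div_pos (by linarith) hs, div_pos haa hs, by field_simp; ring, ?_⟩
  have hx : a.site 0 = p 0 + a.x := by rw [ha.x_eq]; ring
  have hy : a.site 1 = p 1 + a.y := by rw [ha.y_eq]; ring
  have hx' : b.site 0 = p 0 + b.x := by rw [hb.x_eq]; ring
  have hy' : b.site 1 = p 1 + b.y := by rw [hb.y_eq]; ring
  unfold Source.cross at hab
  ext i
  fin_cases i
  · simp only [Fin.zero_eta, PiLp.add_apply, PiLp.smul_apply, smul_eq_mul, hx, hx']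
    field_simp
    unfold Source.inner
    linear_combination (-a.y) * hab
  · simp only [Fin.mk_one, PiLp.add_apply, PiLp.smul_apply, smul_eq_mul, hy, hy']
    field_simp
    unfold Source.inner
    linear_combination a.x * hab

/-! ### Locating the light sources -/

theorem seenFrom_locate (p f : Plane) : (locate p f).val.SeenFrom p where
  x_eq := rfl
  y_eq := rfl
  d_eq := by
    rw [EuclideanSpace.dist_eq, Fin.sum_univ_two, Real.dist_eq, Real.dist_eq, sq_abs, sq_abs]
    simp [locate, pow_two]

theorem time_locate (p f : Plane) : (locate p f).time = 11 := rfl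

theorem val_locateAll (p : Plane) (l : List Plane) :
    (locateAll p l).val = l.map fun f => (locate p f).val := by
  induction l with
  | nil => simp [locateAll]
  | cons f l ih => simp [locateAll, ih]

theorem time_locateAll (p : Plane) (l : List Plane) :
    (locateAll p l).time = 13 * l.length + 1 := by
  induction l with
  | nil => simp [locateAll]
  | cons f l ih => simp [locateAll, ih, time_locate]; omega

theorem seenFrom_of_mem_locateAll {p : Plane} {l : List Plane} {u : Source}
    (hu : u ∈ (locateAll p l).val) : u.SeenFrom p := by
  rw [val_locateAll, List.mem_map] at hu
  obtain ⟨f, _, rfl⟩ := hu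
  exact seenFrom_locate p f

theorem image_site_locateAll (p : Plane) (l : List Plane) (q : ℝ → Prop) :
    Source.site '' {u | u ∈ (locateAll p l).val ∧ q u.d} = {f | f ∈ l ∧ q (dist f p)} := by
  ext f
  simp only [val_locateAll, List.mem_map, mem_image, mem_ofPred_eq]
  constructor
  · rintro ⟨_, ⟨⟨g, hg, rfl⟩, hq⟩, rfl⟩
    exact ⟨hg, by rw [(seenFrom_locate p g).d_eq] at hq; exact hq⟩
  · rintro ⟨hf, hq⟩
    exact ⟨_, ⟨⟨f, hf, rfl⟩, by rw [(seenFrom_locate p f).d_eq]; exact hq⟩, rfl⟩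

/-! ### The search off two lines -/

theorem isEmbracingSet_of_cross_pos {p : Plane} {a b c : Source} (ha : a.SeenFrom p)
    (hb : b.SeenFrom p) (hc : c.SeenFrom p) (hab : 0 < a.cross b) (hbc : 0 < b.cross c)
    (hca : 0 < c.cross a) : IsEmbracingSet {a.site, b.site, c.site} p := by
  rw [← ha.orientation_eq hb] at hab
  rw [← hb.orientation_eq hc] at hbc
  rw [← hc.orientation_eq ha] at hca
  exact isEmbracingSet_triangle p _ _ _ hab hbc hca

theorem time_offCross_le (a m b v : Source) (r : ℝ) (l : List Source) :
    (offCross a m b v r l).time ≤ 13 * l.length + 1 := by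
  induction l with
  | nil => simp [offCross]
  | cons u l ih =>
    rw [List.length_cons]
    by_cases h : r < u.d
    · simp [offCross, h]; omega
    · rcases lt_trichotomy (u.cross m) 0 with h1 | h1 | h1 <;>
      rcases lt_trichotomy (a.cross u) 0 with h2 | h2 | h2 <;>
      simp [offCross, h, h1, h2, h1.not_gt, h2.not_gt] <;> omega

/-- The signs of `u.cross m` and `a.cross u` tell which of the four open sectors contains `u`. The
two rays bounding the opposite sector complete it to a triangle around `p`; a zero sign means that
`u` is on one of the lines. -/
theorem offCross_spec {p : Plane} {S : Set Source} (a m b v : Source) (r : ℝ) (l : List Source)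
    (hK : (Fan.cross a m b v).Represents S) (hS : ∀ u ∈ S, u.SeenFrom p)
    (hl : ∀ u ∈ l, u.SeenFrom p) (hlS : ∀ u ∈ l, u.d ≤ r → u ∈ S) :
    ((offCross a m b v r l).val = none →
      ∀ u ∈ l, u.d ≤ r → a.cross u = 0 ∨ m.cross u = 0) ∧
    ∀ x y z, (offCross a m b v r l).val = some (x, y, z) →
      IsEmbracingSet {x, y, z} p ∧ ({x, y, z} : Set Plane) ⊆ Source.site '' S := by
  induction l with
  | nil => simp [offCross]
  | cons u l ih =>
    rw [List.forall_mem_cons] at hl hlS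
    obtain ⟨ih1, ih2⟩ := ih hl.2 hlS.2
    rw [List.forall_mem_cons]
    by_cases h : r < u.d
    · have e : (offCross a m b v r (u :: l)).val = (offCross a m b v r l).val := by
        simp [offCross, h]
      rw [e]
      exact ⟨fun hn => ⟨fun hu => (hu.not_gt h).elim, ih1 hn⟩, ih2⟩
    have huS := hlS.1 (not_lt.mp h)
    obtain ⟨ha, hm, hb, hv, hab, hab', ham, hmv, hmv'⟩ := hK
    obtain ⟨hmb, hbv, hva⟩ := Source.cross_signs_of_opposite hab hab' ham hmv hmv'
    have haa := Source.inner_self_pos (Source.ne_zero_of_inner_ne hab'.ne)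
    have hmm := Source.inner_self_pos (Source.ne_zero_of_inner_ne hmv'.ne)
    have hbu : a.inner a * u.cross b = -(a.inner b * a.cross u) := by
      rw [Source.inner_self_mul_cross, hab, mul_zero, zero_sub]
    have hvu : m.inner m * v.cross u = -(m.inner v * u.cross m) := by
      rw [Source.inner_self_mul_cross, hmv, mul_zero, sub_zero, Source.cross_swap u m]; ring
    have hau := Source.cross_swap a u
    have hmu := Source.cross_swap m u
    have hbu' := Source.cross_swap b u
    have huv' := Source.cross_swap u v
    have result : ∀ s t w : Source, s ∈ S → t ∈ S → w ∈ S → 0 < s.cross t → 0 < t.cross w →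
        0 < w.cross s → ∀ x y z, ({x, y, z} : Set Plane) = {s.site, t.site, w.site} →
        IsEmbracingSet {x, y, z} p ∧ ({x, y, z} : Set Plane) ⊆ Source.site '' S := by
      intro s t w hs ht hw h1 h2 h3 x y z hxyz
      rw [hxyz]
      refine ⟨isEmbracingSet_of_cross_pos (hS s hs) (hS t ht) (hS w hw) h1 h2 h3, ?_⟩
      rintro _ (rfl | rfl | rfl)
      exacts [mem_image_of_mem _ hs, mem_image_of_mem _ ht, mem_image_of_mem _ hw]
    rcases lt_trichotomy (u.cross m) 0 with h1 | h1 | h1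
    · rcases lt_trichotomy (a.cross u) 0 with h2 | h2 | h2
      · have e : (offCross a m b v r (u :: l)).val = some (u.site, a.site, m.site) := by
          simp [offCross, h, h1, h2, h1.not_gt, h2.not_gt]
        rw [e]
        refine ⟨by simp, ?_⟩
        rintro _ _ _ ⟨⟩
        exact result u a m huS ha hm (by linarith) ham (by linarith) _ _ _ rfl
      · have e : (offCross a m b v r (u :: l)).val = (offCross a m b v r l).val := by
          simp [offCross, h, h1, h2, h1.not_gt]
        rw [e]
        exact ⟨fun hn => ⟨fun _ => Or.inl h2, ih1 hn⟩, ih2⟩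
      · have e : (offCross a m b v r (u :: l)).val = some (u.site, a.site, v.site) := by
          simp [offCross, h, h1, h2, h1.not_gt]
        rw [e]
        refine ⟨by simp, ?_⟩
        rintro _ _ _ ⟨⟩
        refine result a u v ha huS hv h2 ?_ hva _ _ _ (insert_comm _ _ _)
        have : v.cross u < 0 := by
          refine neg_of_mul_neg_right (a := m.inner m) ?_ hmm.le
          rw [hvu]; linarith [mul_pos_of_neg_of_neg hmv' h1]
        linarith
    · have e : (offCross a m b v r (u :: l)).val = (offCross a m b v r l).val := by
        simp [offCross, h, h1]
      rw [e]
      exact ⟨fun hn => ⟨fun _ => Or.inr (by linarith), ih1 hn⟩, ih2⟩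
    · rcases lt_trichotomy (a.cross u) 0 with h2 | h2 | h2
      · have e : (offCross a m b v r (u :: l)).val = some (u.site, b.site, m.site) := by
          simp [offCross, h, h1, h2, h2.not_gt]
        rw [e]
        refine ⟨by simp, ?_⟩
        rintro _ _ _ ⟨⟩
        refine result b u m hb huS hm ?_ h1 hmb _ _ _ (insert_comm _ _ _)
        have : u.cross b < 0 := by
          refine neg_of_mul_neg_right (a := a.inner a) ?_ haa.le
          rw [hbu]; linarith [mul_pos_of_neg_of_neg hab' h2]
        linarith
      · have e : (offCross a m b v r (u :: l)).val = (offCross a m b v r l).val := by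
          simp [offCross, h, h1, h2]
        rw [e]
        exact ⟨fun hn => ⟨fun _ => Or.inl h2, ih1 hn⟩, ih2⟩
      · have e : (offCross a m b v r (u :: l)).val = some (u.site, b.site, v.site) := by
          simp [offCross, h, h1, h2]
        rw [e]
        refine ⟨by simp, ?_⟩
        rintro _ _ _ ⟨⟩
        refine result u b v huS hb hv ?_ hbv ?_ _ _ _ rfl
        · refine pos_of_mul_pos_right (a := a.inner a) ?_ haa.le
          rw [hbu]; linarith [mul_neg_of_neg_of_pos hab' h2]
        · refine pos_of_mul_pos_right (a := m.inner m) ?_ hmm.le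
          rw [hvu]; linarith [mul_neg_of_neg_of_pos hmv' h1]

/-! ### The test and the algorithm on the whole list -/

theorem time_embraceTest_le (p : Plane) (l : List Plane) :
    (embraceTest p l).time ≤ 26 * l.length + 3 := by
  have h1 := time_locateAll p l
  have h2 := Fan.empty.time_extendAll_le (locateAll p l).val
  have h3 : (locateAll p l).val.length = l.length := by simp [val_locateAll]
  simp only [embraceTest, Timed.time_bind, Fan.time_isFull]
  omega

theorem embraceTest_iff (p : Plane) (l : List Plane) :
    (embraceTest p l).val = true ↔ IsEmbracingSet {f | f ∈ l} p := by
  have hseen : ∀ u ∈ (locateAll p l).val, u.SeenFrom p := fun u => seenFrom_of_mem_locateAll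
  have hK : Fan.empty.Represents ∅ := fun u hu => hu.elim
  have h1 := hK.extendAll _ hseen
  rw [empty_union] at h1
  have h2 := image_site_locateAll p l fun _ => True
  simp only [and_true] at h2
  rw [← h2, ← h1.full_iff hseen, ← Fan.val_isFull]
  rfl

theorem time_merPoint_le (p : Plane) (l : List Plane) :
    (merPoint p l).time ≤ 2150 * l.length + 10 := by
  have h1 := time_locateAll p l
  have h2 : (locateAll p l).val.length = l.length := by simp [val_locateAll]
  have h3 := time_search_le (l.length + 1) .empty (locateAll p l).val
  simp only [merPoint, Timed.time_bind, time_len, val_len, addN, val_prim, time_prim, h2]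
  rcases (search (l.length + 1) .empty (locateAll p l).val).val with _ | ⟨f, K⟩
  · simp only [Timed.time_pure]
    omega
  · cases K <;> simp only [time_prim, Timed.time_bind] <;> try omega
    have h4 := time_offCross_le
    rename_i a m b v
    have h5 := h4 a m b v f.d (locateAll p l).val
    omega

/-- Translates the search outcome from records to sites. Only the two full fans can accompany a
site, so the final default branch of `merPoint` is never taken. -/
theorem merPoint_val (p : Plane) (l : List Plane) :
    ((merPoint p l).val = none ∧ ¬ IsEmbracingSet {f | f ∈ l} p) ∨
    ∃ (f : Source) (K : Fan), f ∈ (locateAll p l).val ∧ K.Full ∧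
      K.Represents {u | u ∈ (locateAll p l).val ∧ u.d ≤ f.d} ∧
      ¬ IsEmbracingSet {g | g ∈ l ∧ dist g p < f.d} p ∧
      ((∃ a b c, K = .triangle a b c ∧
          (merPoint p l).val = some ⟨f.site, f.d, some (a.site, b.site, c.site)⟩) ∨
        ∃ a m b v, K = .cross a m b v ∧ (merPoint p l).val =
          some ⟨f.site, f.d, (offCross a m b v f.d (locateAll p l).val).val⟩) := by
  have hseen : ∀ u ∈ (locateAll p l).val, u.SeenFrom p := fun u => seenFrom_of_mem_locateAll
  have hK : Fan.empty.Represents ∅ := fun u hu => hu.elim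
  obtain ⟨h1, h2⟩ := search_spec ((locateAll p l).val.length + 1) .empty ∅ _ (Nat.lt_succ_self _)
    hK (by simp [Fan.Full]) (fun s hs => hs.elim) (fun s hs => hs.elim) hseen
  simp only [empty_union, mem_ofPred_eq] at h1 h2
  have i1 := image_site_locateAll p l fun _ => True
  simp only [and_true] at i1
  rw [i1] at h1
  rcases hs : (search ((locateAll p l).val.length + 1) .empty (locateAll p l).val).val
    with _ | ⟨f, K⟩
  · refine Or.inl ⟨?_, h1 hs⟩
    simp [merPoint, hs]
  · obtain ⟨hf, hfull, hrep, hnot⟩ := h2 f K hs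
    rw [image_site_locateAll p l fun d => d < f.d] at hnot
    refine Or.inr ⟨f, K, hf, hfull, hrep, hnot, ?_⟩
    cases K with
    | triangle a b c => exact Or.inl ⟨a, b, c, rfl, by simp [merPoint, hs]⟩
    | cross a m b v => exact Or.inr ⟨a, m, b, v, rfl, by simp [merPoint, hs]⟩
    | empty => exact hfull.elim
    | ray => exact hfull.elim
    | line => exact hfull.elim
    | wedge => exact hfull.elim
    | halfPlane => exact hfull.elim

/-! ### The embracing range as a threshold -/

section Range

variable {F : Set Plane} {p : Plane} {r : ℝ}

theorem pos_of_isEmbracingSet (h : IsEmbracingSet {g | g ∈ F ∧ dist g p ≤ r} p) : 0 < r := by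
  by_contra! hr
  refine not_isEmbracingSet_of_forall_le _ p 1 0 (by simp) ?_ h
  rintro g ⟨_, hg⟩
  rw [dist_le_zero.mp (hg.trans hr)]
  simp

/-- A range smaller than `r` reaches only sources strictly closer than `r`, which do not embrace
`p`. -/
theorem isMER_of_isEmbracingSet (h : IsEmbracingSet {g | g ∈ F ∧ dist g p ≤ r} p)
    (h' : ¬ IsEmbracingSet {g | g ∈ F ∧ dist g p < r} p) : IsMER F p r := by
  refine ⟨⟨pos_of_isEmbracingSet h, ?_⟩, ?_⟩
  · simpa [WellIlluminated, Metric.mem_closedBall, dist_comm p] using h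
  · rintro s ⟨_, hs⟩
    by_contra! hlt
    refine h' (hs.mono ?_)
    rintro g ⟨hg, hgs⟩
    rw [Metric.mem_closedBall, dist_comm] at hgs
    exact ⟨hg, hgs.trans_lt hlt⟩

theorem isClosestEmbracingSite_of_isEmbracingSet
    (h : IsEmbracingSet {g | g ∈ F ∧ dist g p ≤ r} p)
    (h' : ¬ IsEmbracingSet {g | g ∈ F ∧ dist g p < r} p) {f : Plane} (hf : f ∈ F)
    (hfr : dist f p = r) : IsClosestEmbracingSite F p f := by
  subst hfr
  refine ⟨⟨hf, h⟩, ?_⟩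
  rintro g ⟨_, hg⟩
  by_contra! hlt
  exact h' (hg.mono fun k hk => ⟨hk.1, hk.2.trans_lt hlt⟩)

/-- Some vertex is at distance exactly `r`, since otherwise the strictly closer sources would
already embrace `p`; that vertex is a closest embracing site. -/
theorem isCET_of_isEmbracingSet (h' : ¬ IsEmbracingSet {g | g ∈ F ∧ dist g p < r} p)
    {a b c : Plane} (h : IsEmbracingSet {a, b, c} p)
    (hsub : ({a, b, c} : Set Plane) ⊆ {g | g ∈ F ∧ dist g p ≤ r}) :
    IsCET F p {a, b, c} ∧ p ∈ embracedArea r {a, b, c} := by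
  refine ⟨⟨fun g hg => (hsub hg).1, h.ncard_triple, h, ?_⟩, ?_, h⟩
  · by_contra! hno
    refine h' (h.mono fun g hg => ⟨(hsub hg).1, (hsub hg).2.lt_of_ne fun e => ?_⟩)
    exact hno g hg (isClosestEmbracingSite_of_isEmbracingSet (h.mono hsub) h' (hsub hg).1 e)
  · refine mem_iInter₂.mpr fun g hg => ?_
    rw [Metric.mem_closedBall, dist_comm]
    exact (hsub hg).2

end Range

/-- By the pigeonhole principle two of the three points share a line through `p`, so their
determinant vanishes and the triple cannot embrace `p`. -/
theorem not_mem_embracedArea_of_two_lines {F : Set Plane} {p : Plane} {r : ℝ} {a m : Source}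
    (ha : 0 < a.inner a) (hm : 0 < m.inner m)
    (h : ∀ g ∈ F, dist g p ≤ r →
      ∃ u : Source, u.SeenFrom p ∧ u.site = g ∧ (a.cross u = 0 ∨ m.cross u = 0))
    {T : Set Plane} (hTF : T ⊆ F) (hT : T.ncard = 3) : p ∉ embracedArea r T := by
  rintro ⟨hr, hemb⟩
  obtain ⟨x, y, z, -, -, -, rfl⟩ := ncard_eq_three.mp hT
  have hd : ∀ g ∈ ({x, y, z} : Set Plane), dist g p ≤ r := fun g hg => by
    have := mem_iInter₂.mp hr g hg
    rwa [Metric.mem_closedBall, dist_comm] at this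
  have key : ∀ c u v : Source, 0 < c.inner c → c.cross u = 0 → c.cross v = 0 → u.SeenFrom p →
      v.SeenFrom p → orientation p u.site v.site = 0 := by
    intro c u v hc hu hv hup hvp
    have := Source.inner_self_mul_cross c u v
    rw [hu, hv, mul_zero, mul_zero, sub_zero, mul_eq_zero] at this
    rw [hup.orientation_eq hvp]
    exact this.resolve_left hc.ne'
  obtain ⟨h1, h2, h3⟩ := IsEmbracingSet.orientation_ne_zero hemb
  obtain ⟨u, hu, rfl, hu'⟩ := h x (hTF (by simp)) (hd x (by simp))
  obtain ⟨v, hv, rfl, hv'⟩ := h y (hTF (by simp)) (hd y (by simp))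
  obtain ⟨w, hw, rfl, hw'⟩ := h z (hTF (by simp)) (hd z (by simp))
  rcases hu' with hu' | hu' <;> rcases hv' with hv' | hv' <;> rcases hw' with hw' | hw'
  · exact h1 (key a u v ha hu' hv' hu hv)
  · exact h1 (key a u v ha hu' hv' hu hv)
  · exact h3 (key a u w ha hu' hw' hu hw)
  · exact h2 (key m v w hm hv' hw' hv hw)
  · exact h2 (key a v w ha hv' hw' hv hw)
  · exact h3 (key m u w hm hu' hw' hu hw)
  · exact h1 (key m u v hm hu' hv' hu hv)
  · exact h1 (key m u v hm hu' hv' hu hv)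

end MERPoint

/-! ### The main theorem -/

theorem mainTheorem4 :
    ∃ C : ℕ, ∀ (p : MERPoint.Plane) (F : Finset MERPoint.Plane) (l : List MERPoint.Plane),
      l.Nodup → (∀ f, f ∈ l ↔ f ∈ F) →
      -- the test used in the search is correct and takes linear time
      (((MERPoint.embraceTest p l).val = true ↔ MERPoint.IsEmbracingSet (F : Set MERPoint.Plane) p) ∧
        (F.Nonempty → (MERPoint.embraceTest p l).time ≤ C * F.card)) ∧
      -- the algorithm takes linear time
      (F.Nonempty → (MERPoint.merPoint p l).time ≤ C * F.card) ∧
      -- it reports failure exactly if the light sources do not embrace the point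
      ((MERPoint.merPoint p l).val = none ↔
        ¬ MERPoint.IsEmbracingSet (F : Set MERPoint.Plane) p) ∧
      -- otherwise it returns a closest embracing site, the MER and a CET
      (∀ out : MERPoint.Output, (MERPoint.merPoint p l).val = some out →
        MERPoint.IsMER (F : Set MERPoint.Plane) p out.range ∧
        MERPoint.IsClosestEmbracingSite (F : Set MERPoint.Plane) p out.site ∧
        dist out.site p = out.range ∧
        (∀ a b c : MERPoint.Plane, out.triangle = some (a, b, c) →
          MERPoint.IsCET (F : Set MERPoint.Plane) p {a, b, c} ∧
          p ∈ MERPoint.embracedArea out.range {a, b, c}) ∧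
        -- no triangle is returned only if no three light sources embrace the point with range MER
        (out.triangle = none → ∀ T : Set MERPoint.Plane, T ⊆ (F : Set MERPoint.Plane) →
          T.ncard = 3 → p ∉ MERPoint.embracedArea out.range T) ∧
        -- in particular a triangle is returned unless two segments between light sources cross at p
        ((∀ a ∈ F, ∀ b ∈ F, ∀ c ∈ F, ∀ d ∈ F, p ∈ openSegment ℝ a b → p ∈ openSegment ℝ c d →
            Collinear ℝ ({a, b, c, d} : Set MERPoint.Plane)) →
          out.triangle ≠ none)) := by
  -- For a nonempty list the additive constants are absorbed: `2150 * n + 10 ≤ 2200 * n`.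
  refine ⟨2200, fun p F l hnd hmem => ?_⟩
  have hF : (F : Set MERPoint.Plane) = {f | f ∈ l} := by
    ext f
    exact (hmem f).symm
  have hcard : l.length = F.card := by
    rw [← List.toFinset_card_of_nodup hnd]
    congr 1
    ext f
    rw [List.mem_toFinset, hmem]
  rw [hF]
  have htest := MERPoint.time_embraceTest_le p l
  have halg := MERPoint.time_merPoint_le p l
  refine ⟨⟨MERPoint.embraceTest_iff p l, fun h => ?_⟩, fun h => ?_, ?_⟩
  · have := h.card_pos
    omega
  · have := h.card_pos
    omega
  rcases MERPoint.merPoint_val p l with ⟨hnone, hnot⟩ | ⟨f, K, hf, hfull, hK, hnot, hval⟩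
  · rw [hnone]
    exact ⟨⟨fun _ => hnot, fun _ => rfl⟩, fun out h => by cases h⟩
  have hseen : ∀ u ∈ {u | u ∈ (MERPoint.locateAll p l).val ∧ u.d ≤ f.d}, u.SeenFrom p :=
    fun u hu => MERPoint.seenFrom_of_mem_locateAll hu.1
  have himage := MERPoint.image_site_locateAll p l fun d => d ≤ f.d
  have hemb := hK.isEmbracingSet hseen hfull
  rw [himage] at hemb
  have hfp : dist f.site p = f.d := (MERPoint.seenFrom_of_mem_locateAll hf).d_eq.symm
  have hfl : f.site ∈ {g | g ∈ l ∧ dist g p ≤ f.d} := by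
    rw [← himage]
    exact mem_image_of_mem _ ⟨hf, le_rfl⟩
  have hMER := MERPoint.isMER_of_isEmbracingSet (F := {f | f ∈ l}) hemb hnot
  have hsite := MERPoint.isClosestEmbracingSite_of_isEmbracingSet (F := {f | f ∈ l}) hemb hnot
    hfl.1 hfp
  have hembF : MERPoint.IsEmbracingSet {f | f ∈ l} p := hemb.mono fun g hg => hg.1
  have hsites : ∀ u ∈ {u | u ∈ (MERPoint.locateAll p l).val ∧ u.d ≤ f.d},
      u.site ∈ {g | g ∈ l ∧ dist g p ≤ f.d} := fun u hu => himage ▸ mem_image_of_mem _ hu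
  rcases hval with ⟨a, b, c, rfl, hval⟩ | ⟨a, m, b, v, rfl, hval⟩
  · rw [hval]
    refine ⟨by simpa using hembF, ?_⟩
    rintro _ ⟨⟩
    refine ⟨hMER, hsite, hfp, ?_, by simp, by simp⟩
    rintro _ _ _ ⟨⟩
    obtain ⟨ha, hb, hc, h1, h2, h3⟩ := hK
    refine MERPoint.isCET_of_isEmbracingSet hnot (MERPoint.isEmbracingSet_of_cross_pos
      (hseen a ha) (hseen b hb) (hseen c hc) h1 h2 h3) ?_
    rintro _ (rfl | rfl | rfl)
    exacts [hsites a ha, hsites b hb, hsites c hc]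
  · rw [hval]
    refine ⟨by simpa using hembF, ?_⟩
    rintro _ ⟨⟩
    obtain ⟨hoff, htri⟩ := MERPoint.offCross_spec a m b v f.d (MERPoint.locateAll p l).val hK hseen
      (fun u hu => MERPoint.seenFrom_of_mem_locateAll hu) (fun u hu hd => ⟨hu, hd⟩)
    rw [himage] at htri
    have htriangle := fun x y z h => MERPoint.isCET_of_isEmbracingSet (F := {f | f ∈ l}) hnot
      (htri x y z h).1 (htri x y z h).2
    obtain ⟨ha, hm, hb, hv, hab, hab', ham, hmv, hmv'⟩ := hK
    refine ⟨hMER, hsite, hfp, htriangle, fun hn T hT hT3 => ?_, fun hseg _ => ?_⟩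
    · refine MERPoint.not_mem_embracedArea_of_two_lines
        (MERPoint.Source.inner_self_pos (MERPoint.Source.ne_zero_of_inner_ne hab'.ne))
        (MERPoint.Source.inner_self_pos (MERPoint.Source.ne_zero_of_inner_ne hmv'.ne))
        (fun g hg hd => ?_) hT hT3
      have hg' : g ∈ {g | g ∈ l ∧ dist g p ≤ f.d} := ⟨hg, hd⟩
      rw [← himage] at hg'
      obtain ⟨u, hu, rfl⟩ := hg'
      exact ⟨u, hseen u hu, rfl, hoff hn u hu.1 hu.2⟩
    · have hcol := hseg a.site ((hmem _).mp (hsites a ha).1) b.site ((hmem _).mp (hsites b hb).1)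
        m.site ((hmem _).mp (hsites m hm).1) v.site ((hmem _).mp (hsites v hv).1)
        (MERPoint.mem_openSegment_of_opposite (hseen a ha) (hseen b hb) hab hab')
        (MERPoint.mem_openSegment_of_opposite (hseen m hm) (hseen v hv) hmv hmv')
      -- The two segments of the cross meet at `p`, so the hypothesis makes the four sources
      -- collinear; but these four alone embrace `p`. Hence a cross cannot occur at all under this
      -- hypothesis.
      have hfour : (MERPoint.Fan.cross a m b v).Represents {a, b, m, v} :=
        ⟨by simp, by simp, by simp, by simp, hab, hab', ham, hmv, hmv'⟩
      have hfour' := hfour.isEmbracingSet (p := p) (by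
        rintro _ (rfl | rfl | rfl | rfl)
        exacts [hseen _ ha, hseen _ hb, hseen _ hm, hseen _ hv]) trivial
      rw [image_insert_eq, image_insert_eq, image_insert_eq, image_singleton] at hfour'
      exact hfour'.not_collinear hcol
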